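/- Let $\ell$ be a prime and let $G$ be a (topologically) finitely generated pro-$\ell$ group whose abelianization $G^{\mathrm{ab}}$ (the quotient by the closure of the commutator subgroup) is torsion-free. Let $\mathbb{Z}_\ell[[G]]=\varprojlim_N\mathbb{Z}_\ell[G/N]$ be the completed group ring, $\mathscr I$ its augmentation ideal, $V=\mathscr I/\mathscr I^2$ and $U=\mathscr I^2/\mathscr I^3$. Let $\operatorname{Aut}(G)$ be the group of continuous automorphisms of $G$ with its profinite (compact-open) topology, acting on all these objects, and let $\operatorname{Out}(G)$ be its quotient by the inner automorphisms. All $H^1$ are continuous cohomology groups. Let $\mathrm{MD}_{\mathrm{univ}}\in H^1(\operatorname{Aut}(G),\operatorname{Hom}(V,U))$ be the class of the extension $0\to\mathscr I^2/\mathscr I^3\to\mathscr I/\mathscr I^3\to\mathscr I/\mathscr I^2\to 0$, i.e. the class of the cocycle $\sigma\mapsto \sigma\circ s\circ\sigma^{-1}-s$ for any $\mathbb{Z}_\ell$-linear section $s$ of $\mathscr I/\mathscr I^3\to\mathscr I/\mathscr I^2$. Let $m:V\to\operatorname{Hom}(V,U)$, $x\mapsto(y\mapsto xy-yx)$, be the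 commutator map and $A(G)=\operatorname{coker}(m)$; inner automorphisms act trivially on $\operatorname{Hom}(V,U)$ and on $A(G)$. Let $J_{\mathrm{univ}}\in H^1(\operatorname{Out}(G),A(G))$ be the unique class whose inflation to $H^1(\operatorname{Aut}(G),A(G))$ is the image of $\mathrm{MD}_{\mathrm{univ}}$. Let $\operatorname{Alt}^2V\subset V\otimes_{\mathbb{Z}_\ell} V$ be the submodule of tensors on which the swap $v_1\otimes v_2\mapsto v_2\otimes v_1$ acts as $-1$, let $W\subset U$ be the image of $\operatorname{Alt}^2V$ under multiplication $V\otimes V\to U$, and let $A_W(G)=\operatorname{coker}(m:V\to\operatorname{Hom}(V,W))$ (the image of $m$ lies in $\operatorname{Hom}(V,W)$). The classes $\mathrm{MD}_{\mathrm{univ}}$ and $J_{\mathrm{univ}}$ exist and are unique. Suppose that some $\sigma\in\operatorname{Aut}(G)$ acts on $G^{\mathrm{ab}}$ as multiplication by $-1$. Then: 1. The class $4\,\mathrm{MD}_{\mathrm{univ}}$ lies in the image of the natural map $H^1(\operatorname{Aut}(G),\operatorname{Hom}(V,W))\to H^1(\operatorname{Aut}(G),\operatorname{Hom}(V,U))$.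 If moreover $H^0(\operatorname{Aut}(G),\operatorname{Hom}(V,U)\otimes\mathbb{Z}_\ell/2)=0$, then $2\,\mathrm{MD}_{\mathrm{univ}}$ has a unique preimage under this map. 2. The class $4J_{\mathrm{univ}}$ lies in the image of the natural map $H^1(\operatorname{Out}(G),A_W(G))\to H^1(\operatorname{Out}(G),A(G))$. If moreover $H^0(\operatorname{Out}(G),\operatorname{Hom}(V,U)\otimes\mathbb{Z}_\ell/2)=0$, then $2J_{\mathrm{univ}}$ has a unique preimage under this map. -/

import Mathlib

open scoped TensorProduct

universe u

namespace ProEll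

/-! ### Automorphisms and outer automorphisms of a topological group -/

section Automorphisms

/-- `Aut(G)`: the automorphisms of the topological group `G` (bicontinuous group automorphisms). -/
def ContAut (G : Type u) [Group G] [TopologicalSpace G] : Type u := G ≃ₜ* G

variable {G : Type u} [Group G] [TopologicalSpace G]

instance : EquivLike (ContAut G) G G := inferInstanceAs (EquivLike (G ≃ₜ* G) G G)

instance : MulEquivClass (ContAut G) G G := inferInstanceAs (MulEquivClass (G ≃ₜ* G) G G)

theorem ContAut.continuous (σ : ContAut G) : Continuous σ :=
  ContinuousMulEquiv.continuous_toFun σ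

theorem ContAut.ext {σ τ : ContAut G} (h : ∀ g, σ g = τ g) : σ = τ := DFunLike.ext σ τ h

/-- The group structure is composition: `(σ * τ) g = σ (τ g)`. -/
instance : Group (ContAut G) where
  mul σ τ := ContinuousMulEquiv.trans τ σ
  one := ContinuousMulEquiv.refl G
  inv σ := ContinuousMulEquiv.symm σ
  mul_assoc _ _ _ := rfl
  one_mul _ := rfl
  mul_one _ := rfl
  inv_mul_cancel σ := ContAut.ext fun g => ContinuousMulEquiv.symm_apply_apply σ g

theorem ContAut.mul_apply (σ τ : ContAut G) (g : G) : (σ * τ) g = σ (τ g) := rfl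

theorem ContAut.one_apply (g : G) : (1 : ContAut G) g = g := rfl

theorem ContAut.apply_inv_apply (σ : ContAut G) (g : G) : σ (σ⁻¹ g) = g := by
  rw [← ContAut.mul_apply, mul_inv_cancel, ContAut.one_apply]

/-- The compact-open topology on `Aut(G)`. For `G` profinite this is the topology of uniform
convergence: `σ` and `τ` are close if they agree modulo a small open normal subgroup. -/
instance : TopologicalSpace (ContAut G) :=
  TopologicalSpace.induced (fun σ => (⟨σ, σ.continuous⟩ : C(G, G))) inferInstance

variable [IsTopologicalGroup G]

/-- The map `G → Aut(G)`, `g ↦ (x ↦ g x g⁻¹)`. -/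
def conj : G →* ContAut G where
  toFun g :=
    { MulAut.conj g with
      continuous_toFun := by
        change Continuous fun x => g * x * g⁻¹
        fun_prop
      continuous_invFun := by
        change Continuous fun x => g⁻¹ * x * g
        fun_prop }
  map_one' := ContAut.ext fun x => by
    change 1 * x * 1⁻¹ = x
    simp
  map_mul' g h := ContAut.ext fun x => by
    change g * h * x * (g * h)⁻¹ = g * (h * x * h⁻¹) * g⁻¹
    group

theorem conj_apply (g x : G) : conj g x = g * x * g⁻¹ := rfl

variable (G) in
/-- The inner automorphisms of `G`. -/
def Inn : Subgroup (ContAut G) := (conj (G := G)).range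

instance : (Inn G).Normal where
  conj_mem := by
    rintro _ ⟨g, rfl⟩ σ
    refine ⟨σ g, ContAut.ext fun x => ?_⟩
    simp only [ContAut.mul_apply, conj_apply, map_mul, map_inv, ContAut.apply_inv_apply]

variable (G) in
/-- `Out(G) = Aut(G) / Inn(G)`, with the quotient topology. -/
abbrev ContOut : Type u := ContAut G ⧸ Inn G

end Automorphisms

/-! ### The completed group ring `ℤ_ℓ[[G]]` -/

section CompletedGroupRing

variable (ℓ : ℕ) [Fact ℓ.Prime]
variable {G : Type u} [Group G] [TopologicalSpace G]

/-- The map `ℤ_ℓ[G/N] → ℤ_ℓ[G/M]` induced by an endomorphism `φ` of `G` carrying `N` into `M`. -/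
noncomputable def transition (φ : G →* G) {N M : OpenNormalSubgroup G}
    (h : ∀ g ∈ N.toSubgroup, φ g ∈ M.toSubgroup) :
    MonoidAlgebra ℤ_[ℓ] (G ⧸ N.toSubgroup) →ₐ[ℤ_[ℓ]] MonoidAlgebra ℤ_[ℓ] (G ⧸ M.toSubgroup) :=
  MonoidAlgebra.mapDomainAlgHom ℤ_[ℓ] ℤ_[ℓ]
    (QuotientGroup.map N.toSubgroup M.toSubgroup φ h)

theorem transition_single (φ : G →* G) {N M : OpenNormalSubgroup G}
    (h : ∀ g ∈ N.toSubgroup, φ g ∈ M.toSubgroup) (g : G) (a : ℤ_[ℓ]) :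
    transition ℓ φ h (MonoidAlgebra.single (g : G ⧸ N.toSubgroup) a) =
      MonoidAlgebra.single (φ g : G ⧸ M.toSubgroup) a := by
  simp only [transition, MonoidAlgebra.mapDomainAlgHom_apply, MonoidAlgebra.mapDomain_single]
  rfl

theorem transition_transition (φ ψ : G →* G) {N M L : OpenNormalSubgroup G}
    (h : ∀ g ∈ N.toSubgroup, φ g ∈ M.toSubgroup) (h' : ∀ g ∈ M.toSubgroup, ψ g ∈ L.toSubgroup)
    (h'' : ∀ g ∈ N.toSubgroup, (ψ.comp φ) g ∈ L.toSubgroup)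
    (x : MonoidAlgebra ℤ_[ℓ] (G ⧸ N.toSubgroup)) :
    transition ℓ ψ h' (transition ℓ φ h x) = transition ℓ (ψ.comp φ) h'' x := by
  rw [← AlgHom.comp_apply]
  simp only [transition, ← MonoidAlgebra.mapDomainAlgHom_comp]
  congr 2
  ext g
  rfl

variable (G) in
/-- The compatible families in `∏_N ℤ_ℓ[G/N]`, `N` ranging over the open normal subgroups. -/
noncomputable def compatibleFamilies :
    Subalgebra ℤ_[ℓ] (∀ N : OpenNormalSubgroup G, MonoidAlgebra ℤ_[ℓ] (G ⧸ N.toSubgroup)) where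
  carrier := {f | ∀ (N M : OpenNormalSubgroup G)
    (h : ∀ g ∈ N.toSubgroup, MonoidHom.id G g ∈ M.toSubgroup),
    transition ℓ (MonoidHom.id G) h (f N) = f M}
  mul_mem' hf hg N M h := by simp [hf N M h, hg N M h]
  add_mem' hf hg N M h := by simp [hf N M h, hg N M h]
  algebraMap_mem' r N M h := by
    rw [Pi.algebraMap_apply, Pi.algebraMap_apply, AlgHom.commutes]

variable (G) in
/-- The completed group ring `ℤ_ℓ[[G]] = lim ℤ_ℓ[G/N]`, `N` ranging over the open normal
subgroups of `G`. -/
def CompletedGroupRing : Type u := compatibleFamilies ℓ G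

noncomputable instance : Ring (CompletedGroupRing ℓ G) :=
  inferInstanceAs (Ring (compatibleFamilies ℓ G))

noncomputable instance : Algebra ℤ_[ℓ] (CompletedGroupRing ℓ G) :=
  inferInstanceAs (Algebra ℤ_[ℓ] (compatibleFamilies ℓ G))

variable {ℓ}

namespace CompletedGroupRing

variable (ℓ) in
/-- The projection `ℤ_ℓ[[G]] → ℤ_ℓ[G/N]`. -/
noncomputable def proj (N : OpenNormalSubgroup G) :
    CompletedGroupRing ℓ G →ₐ[ℤ_[ℓ]] MonoidAlgebra ℤ_[ℓ] (G ⧸ N.toSubgroup) :=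
  (Pi.evalAlgHom ℤ_[ℓ] _ N).comp (compatibleFamilies ℓ G).val

theorem ext {x y : CompletedGroupRing ℓ G} (h : ∀ N, proj ℓ N x = proj ℓ N y) : x = y :=
  Subtype.ext (funext h)

theorem transition_proj (x : CompletedGroupRing ℓ G) {N M : OpenNormalSubgroup G}
    (h : ∀ g ∈ N.toSubgroup, MonoidHom.id G g ∈ M.toSubgroup) :
    transition ℓ (MonoidHom.id G) h (proj ℓ N x) = proj ℓ M x :=
  x.2 N M h

/-- The inverse limit topology, each `ℤ_ℓ[G/N]` having the product topology of the coefficients. -/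
noncomputable instance : TopologicalSpace (CompletedGroupRing ℓ G) :=
  TopologicalSpace.induced
    (fun x (N : OpenNormalSubgroup G) (q : G ⧸ N.toSubgroup) => (proj ℓ N x).coeff q) inferInstance

/-- The coefficients of an element, as an additive map. -/
noncomputable def coeffHom : CompletedGroupRing ℓ G →+
    (∀ N : OpenNormalSubgroup G, G ⧸ N.toSubgroup → ℤ_[ℓ]) where
  toFun x N q := (proj ℓ N x).coeff q
  map_zero' := by
    ext N q
    simp
  map_add' x y := by
    ext N q
    simp

instance : IsTopologicalAddGroup (CompletedGroupRing ℓ G) :=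
  topologicalAddGroup_induced (coeffHom (ℓ := ℓ) (G := G))

variable (ℓ) in
/-- The element `[g]` of `ℤ_ℓ[[G]]`. -/
noncomputable def of : G →* CompletedGroupRing ℓ G where
  toFun g := ⟨fun N => MonoidAlgebra.single (g : G ⧸ N.toSubgroup) 1, fun _ _ h =>
    transition_single ℓ _ h g 1⟩
  map_one' := rfl
  map_mul' g h := ext fun N => by
    change MonoidAlgebra.single ((g * h : G) : G ⧸ N.toSubgroup) (1 : ℤ_[ℓ]) = MonoidAlgebra.single (g : G ⧸ N.toSubgroup) (1 : ℤ_[ℓ]) * MonoidAlgebra.single (h : G ⧸ N.toSubgroup) 1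
    rw [MonoidAlgebra.single_mul_single, one_mul]
    rfl

theorem proj_of (g : G) (N : OpenNormalSubgroup G) :
    proj ℓ N (of ℓ g) = MonoidAlgebra.single (g : G ⧸ N.toSubgroup) 1 := rfl

/-- The inverse image of an open normal subgroup under an automorphism. -/
def pullback (σ : ContAut G) (N : OpenNormalSubgroup G) : OpenNormalSubgroup G where
  toOpenSubgroup := N.toOpenSubgroup.comap (σ : G →* G) σ.continuous
  isNormal' := Subgroup.Normal.comap N.isNormal' (σ : G →* G)

theorem pullback_le (σ : ContAut G) (N : OpenNormalSubgroup G) :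
    ∀ g ∈ (pullback σ N).toSubgroup, (σ : G →* G) g ∈ N.toSubgroup := fun _ h => h

/-- The action of an automorphism `σ` on `ℤ_ℓ[[G]]`, characterised by `[g] ↦ [σ g]` and
compatibility with the limit. -/
noncomputable def map (σ : ContAut G) : CompletedGroupRing ℓ G →ₐ[ℤ_[ℓ]] CompletedGroupRing ℓ G :=
  AlgHom.codRestrict
    (AlgHom.pi fun N => (transition ℓ (σ : G →* G) (pullback_le σ N)).comp
      (proj ℓ (pullback σ N)))
    (compatibleFamilies ℓ G) (by
      intro x N M h
      have h1 : ∀ g ∈ (pullback σ N).toSubgroup, MonoidHom.id G g ∈ (pullback σ M).toSubgroup :=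
        fun _ hg => h _ hg
      have h2 : ∀ g ∈ (pullback σ N).toSubgroup, (σ : G →* G) g ∈ M.toSubgroup :=
        fun _ hg => h _ hg
      change transition ℓ (MonoidHom.id G) h
        (transition ℓ (σ : G →* G) (pullback_le σ N) (proj ℓ (pullback σ N) x)) =
        transition ℓ (σ : G →* G) (pullback_le σ M) (proj ℓ (pullback σ M) x)
      rw [← transition_proj x h1, transition_transition ℓ _ _ _ _ h2,
        transition_transition ℓ _ _ _ _ h2]
      rfl)

theorem proj_map (σ : ContAut G) (x : CompletedGroupRing ℓ G) (N : OpenNormalSubgroup G) :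
    proj ℓ N (map σ x) =
      transition ℓ (σ : G →* G) (pullback_le σ N) (proj ℓ (pullback σ N) x) := rfl

theorem map_of (σ : ContAut G) (g : G) : map σ (of ℓ g) = of ℓ (σ g) :=
  ext fun N => by
    rw [proj_map, proj_of, transition_single, proj_of]
    rfl

theorem map_one_apply (x : CompletedGroupRing ℓ G) : map (1 : ContAut G) x = x :=
  ext fun N => transition_proj x (pullback_le (1 : ContAut G) N)

theorem map_mul_apply (σ τ : ContAut G) (x : CompletedGroupRing ℓ G) :
    map (σ * τ) x = map σ (map τ x) :=
  ext fun N => by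
    rw [proj_map, proj_map, proj_map, transition_transition ℓ _ _ _ _ (fun _ h => h)]
    rfl

/-- An inner automorphism acts on `ℤ_ℓ[[G]]` as `x ↦ [g] x [g⁻¹]`. -/
theorem map_conj [IsTopologicalGroup G] (g : G) (x : CompletedGroupRing ℓ G) :
    map (conj g) x = of ℓ g * x * of ℓ g⁻¹ := by
  refine ext fun N => ?_
  have h : ∀ y ∈ (pullback (conj g) N).toSubgroup, MonoidHom.id G y ∈ N.toSubgroup := by
    intro y hy
    change y ∈ N.toSubgroup
    have h1 : g * y * g⁻¹ ∈ N.toSubgroup := hy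
    have h2 := N.isNormal'.conj_mem _ h1 g⁻¹
    have h3 : g⁻¹ * (g * y * g⁻¹) * g⁻¹⁻¹ = y := by group
    rwa [h3] at h2
  rw [proj_map, map_mul, map_mul, proj_of, proj_of, ← transition_proj x h]
  induction proj ℓ (pullback (conj g) N) x using MonoidAlgebra.induction_linear with
  | zero => simp
  | add a b ha hb => rw [map_add, map_add, ha, hb, mul_add, add_mul]
  | single q a =>
    induction q using QuotientGroup.induction_on with
    | H y =>
      rw [transition_single, transition_single, MonoidAlgebra.single_mul_single,
        MonoidAlgebra.single_mul_single, one_mul, mul_one]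
      rfl

end CompletedGroupRing

end CompletedGroupRing

/-! ### The augmentation ideal, its powers, and their subquotients -/

section Augmentation

open CompletedGroupRing

variable (ℓ : ℕ) [Fact ℓ.Prime]
variable (G : Type u) [Group G] [TopologicalSpace G]

/-- The whole group, as an open normal subgroup. -/
def wholeGroup : OpenNormalSubgroup G where
  toOpenSubgroup := ⊤
  isNormal' := (inferInstance : (⊤ : Subgroup G).Normal)

/-- The augmentation `ℤ_ℓ[[G]] → ℤ_ℓ[G/G] → ℤ_ℓ`. -/
noncomputable def augmentation : CompletedGroupRing ℓ G →ₐ[ℤ_[ℓ]] ℤ_[ℓ] :=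
  (MonoidAlgebra.lift ℤ_[ℓ] ℤ_[ℓ] (G ⧸ (wholeGroup G).toSubgroup) 1).comp (proj ℓ (wholeGroup G))

/-- The augmentation ideal `I` of `ℤ_ℓ[[G]]`, as a `ℤ_ℓ`-submodule. -/
noncomputable def augIdeal : Submodule ℤ_[ℓ] (CompletedGroupRing ℓ G) :=
  LinearMap.ker (augmentation ℓ G).toLinearMap

variable {ℓ G}

theorem lift_transition (φ : G →* G) {N M : OpenNormalSubgroup G}
    (h : ∀ g ∈ N.toSubgroup, φ g ∈ M.toSubgroup)
    (x : MonoidAlgebra ℤ_[ℓ] (G ⧸ N.toSubgroup)) :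
    MonoidAlgebra.lift ℤ_[ℓ] ℤ_[ℓ] (G ⧸ M.toSubgroup) 1 (transition ℓ φ h x) =
      MonoidAlgebra.lift ℤ_[ℓ] ℤ_[ℓ] (G ⧸ N.toSubgroup) 1 x := by
  induction x using MonoidAlgebra.induction_linear with
  | zero => simp
  | add a b ha hb => rw [map_add, map_add, map_add, ha, hb]
  | single q a =>
    induction q using QuotientGroup.induction_on with
    | H y => simp [transition_single]

theorem augmentation_map (σ : ContAut G) (x : CompletedGroupRing ℓ G) :
    augmentation ℓ G (CompletedGroupRing.map σ x) = augmentation ℓ G x := by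
  have h : ∀ g ∈ (pullback σ (wholeGroup G)).toSubgroup,
      MonoidHom.id G g ∈ (wholeGroup G).toSubgroup := fun _ _ => trivial
  simp only [augmentation, AlgHom.comp_apply]
  rw [proj_map, lift_transition, ← transition_proj x h, lift_transition]

theorem augmentation_of (g : G) : augmentation ℓ G (of ℓ g) = 1 := by
  simp only [augmentation, AlgHom.comp_apply]
  rw [proj_of]
  simp

theorem of_sub_one_mem (g : G) : of ℓ g - 1 ∈ augIdeal ℓ G := by
  change augmentation ℓ G (of ℓ g - 1) = 0
  rw [map_sub, augmentation_of, map_one, sub_self]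

theorem augIdeal_sq_le : augIdeal ℓ G ^ 2 ≤ augIdeal ℓ G := by
  rw [pow_two, Submodule.mul_le]
  intro x hx y _
  change augmentation ℓ G (x * y) = 0
  have hx0 : augmentation ℓ G x = 0 := hx
  rw [map_mul, hx0, zero_mul]

theorem augIdeal_pow_succ_le (n : ℕ) : augIdeal ℓ G ^ (n + 2) ≤ augIdeal ℓ G ^ (n + 1) := by
  rw [pow_add, pow_add, pow_one]
  exact mul_le_mul_right augIdeal_sq_le _

theorem augIdeal_pow_map_le (σ : ContAut G) (n : ℕ) :
    augIdeal ℓ G ^ n ≤ (augIdeal ℓ G ^ n).comap (CompletedGroupRing.map σ).toLinearMap := by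
  rw [← Submodule.map_le_iff_le_comap, Submodule.map_pow]
  refine pow_le_pow_left' ?_ n
  rintro _ ⟨x, hx, rfl⟩
  exact (augmentation_map σ x).trans hx

variable (ℓ G)

/-- The subquotient `I^m / I^n` of `ℤ_ℓ[[G]]` (used for `n ≥ m ≥ 1`).
The power `I^m` is the `ℤ_ℓ`-span of the `m`-fold products of elements of `I`; as `I` is a two-sided
ideal, this is the usual power of the ideal. -/
def AugQuot (m n : ℕ) : Type u :=
  ↥(augIdeal ℓ G ^ m) ⧸ (augIdeal ℓ G ^ n).submoduleOf (augIdeal ℓ G ^ m)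

noncomputable instance (m n : ℕ) : AddCommGroup (AugQuot ℓ G m n) :=
  inferInstanceAs (AddCommGroup (↥(augIdeal ℓ G ^ m) ⧸
    (augIdeal ℓ G ^ n).submoduleOf (augIdeal ℓ G ^ m)))

noncomputable instance (m n : ℕ) : Module ℤ_[ℓ] (AugQuot ℓ G m n) :=
  inferInstanceAs (Module ℤ_[ℓ] (↥(augIdeal ℓ G ^ m) ⧸
    (augIdeal ℓ G ^ n).submoduleOf (augIdeal ℓ G ^ m)))

/-- The quotient of the subspace topology. -/
noncomputable instance (m n : ℕ) : TopologicalSpace (AugQuot ℓ G m n) :=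
  inferInstanceAs (TopologicalSpace (↥(augIdeal ℓ G ^ m) ⧸
    (augIdeal ℓ G ^ n).submoduleOf (augIdeal ℓ G ^ m)))

instance (m n : ℕ) : IsTopologicalAddGroup (AugQuot ℓ G m n) :=
  inferInstanceAs (IsTopologicalAddGroup (↥(augIdeal ℓ G ^ m) ⧸
    (augIdeal ℓ G ^ n).submoduleOf (augIdeal ℓ G ^ m)))

/-- The quotient map `I^m → I^m / I^n`. -/
noncomputable def AugQuot.mk (m n : ℕ) : ↥(augIdeal ℓ G ^ m) →ₗ[ℤ_[ℓ]] AugQuot ℓ G m n :=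
  Submodule.mkQ _

variable {ℓ G} in
theorem AugQuot.mk_surjective {m n : ℕ} : Function.Surjective (AugQuot.mk ℓ G m n) :=
  Submodule.mkQ_surjective _

variable {ℓ G} in
theorem AugQuot.mk_eq_zero {m n : ℕ} {x : ↥(augIdeal ℓ G ^ m)} :
    AugQuot.mk ℓ G m n x = 0 ↔ x.1 ∈ augIdeal ℓ G ^ n :=
  Submodule.Quotient.mk_eq_zero _

variable {ℓ G} in
/-- A linear map on `I^m` that vanishes on `I^n` factors through `I^m / I^n`. -/
noncomputable def AugQuot.lift {m n : ℕ} {M : Type*} [AddCommGroup M] [Module ℤ_[ℓ] M]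
    (f : ↥(augIdeal ℓ G ^ m) →ₗ[ℤ_[ℓ]] M) (h : ∀ x, x.1 ∈ augIdeal ℓ G ^ n → f x = 0) :
    AugQuot ℓ G m n →ₗ[ℤ_[ℓ]] M :=
  Submodule.liftQ _ f h

variable {ℓ G} in
theorem AugQuot.lift_mk {m n : ℕ} {M : Type*} [AddCommGroup M] [Module ℤ_[ℓ] M]
    (f : ↥(augIdeal ℓ G ^ m) →ₗ[ℤ_[ℓ]] M) (h : ∀ x, x.1 ∈ augIdeal ℓ G ^ n → f x = 0)
    (x : ↥(augIdeal ℓ G ^ m)) : AugQuot.lift f h (AugQuot.mk ℓ G m n x) = f x := rfl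

/-- The action of `Aut(G)` on `I^m`. -/
noncomputable def augPowRep (m : ℕ) :
    Representation ℤ_[ℓ] (ContAut G) ↥(augIdeal ℓ G ^ m) where
  toFun σ := (CompletedGroupRing.map σ).toLinearMap.restrict (augIdeal_pow_map_le σ m)
  map_one' := LinearMap.ext fun x => Subtype.ext (CompletedGroupRing.map_one_apply x.1)
  map_mul' σ τ := LinearMap.ext fun x => Subtype.ext (CompletedGroupRing.map_mul_apply σ τ x.1)

/-- The action of `Aut(G)` on `I^m / I^n`. -/
noncomputable def augRep (m n : ℕ) : Representation ℤ_[ℓ] (ContAut G) (AugQuot ℓ G m n) where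
  toFun σ := AugQuot.lift (AugQuot.mk ℓ G m n ∘ₗ augPowRep ℓ G m σ) fun _ hx =>
    AugQuot.mk_eq_zero.2 (augIdeal_pow_map_le σ n hx)
  map_one' := LinearMap.ext fun x => by
    obtain ⟨x, rfl⟩ := AugQuot.mk_surjective x
    exact congrArg (AugQuot.mk ℓ G m n) (LinearMap.congr_fun (map_one (augPowRep ℓ G m)) x)
  map_mul' σ τ := LinearMap.ext fun x => by
    obtain ⟨x, rfl⟩ := AugQuot.mk_surjective x
    exact congrArg (AugQuot.mk ℓ G m n) (LinearMap.congr_fun (map_mul (augPowRep ℓ G m) σ τ) x)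

variable {ℓ G} in
theorem augRep_mk {m n : ℕ} (σ : ContAut G) (x : ↥(augIdeal ℓ G ^ m)) :
    augRep ℓ G m n σ (AugQuot.mk ℓ G m n x) = AugQuot.mk ℓ G m n (augPowRep ℓ G m σ x) := rfl

/-- `V = I/I²`. -/
abbrev V : Type u := AugQuot ℓ G 1 2

/-- `U = I²/I³`. -/
abbrev U : Type u := AugQuot ℓ G 2 3

/-- `E = I/I³`. -/
abbrev E : Type u := AugQuot ℓ G 1 3

/-- The inclusion `I²/I³ → I/I³`. -/
noncomputable def inclUE : U ℓ G →ₗ[ℤ_[ℓ]] E ℓ G :=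
  AugQuot.lift (AugQuot.mk ℓ G 1 3 ∘ₗ Submodule.inclusion (augIdeal_pow_succ_le 0))
    fun _ hx => AugQuot.mk_eq_zero.2 hx

/-- The projection `I/I³ → I/I²`. -/
noncomputable def projEV : E ℓ G →ₗ[ℤ_[ℓ]] V ℓ G :=
  AugQuot.lift (AugQuot.mk ℓ G 1 2) fun _ hx => AugQuot.mk_eq_zero.2 (augIdeal_pow_succ_le 1 hx)

variable {ℓ G} in
theorem mul_mem_pow {m n : ℕ} {x y : CompletedGroupRing ℓ G} (hx : x ∈ augIdeal ℓ G ^ m)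
    (hy : y ∈ augIdeal ℓ G ^ n) : x * y ∈ augIdeal ℓ G ^ (m + n) := by
  rw [pow_add]
  exact Submodule.mul_mem_mul hx hy

/-- The product `I × I → I²/I³`. -/
noncomputable def mulAux :
    ↥(augIdeal ℓ G ^ 1) →ₗ[ℤ_[ℓ]] ↥(augIdeal ℓ G ^ 1) →ₗ[ℤ_[ℓ]] U ℓ G :=
  LinearMap.mk₂ ℤ_[ℓ]
    (fun x y => AugQuot.mk ℓ G 2 3 ⟨x.1 * y.1, mul_mem_pow x.2 y.2⟩)
    (fun x x' y => by
      rw [← map_add]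
      exact congrArg _ (Subtype.ext (add_mul x.1 x'.1 y.1)))
    (fun c x y => by
      rw [← map_smul]
      exact congrArg _ (Subtype.ext (smul_mul_assoc c x.1 y.1)))
    (fun x y y' => by
      rw [← map_add]
      exact congrArg _ (Subtype.ext (mul_add x.1 y.1 y'.1)))
    (fun c x y => by
      rw [← map_smul]
      exact congrArg _ (Subtype.ext (mul_smul_comm c x.1 y.1)))

/-- The product `V × V → U`, `(x, y) ↦ xy`. -/
noncomputable def mulV : V ℓ G →ₗ[ℤ_[ℓ]] V ℓ G →ₗ[ℤ_[ℓ]] U ℓ G :=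
  AugQuot.lift
    (LinearMap.flip (AugQuot.lift (LinearMap.flip (mulAux ℓ G)) fun y hy =>
      LinearMap.ext fun x => AugQuot.mk_eq_zero.2 (mul_mem_pow (m := 1) (n := 2) x.2 hy)))
    fun x hx => LinearMap.ext fun y => by
      obtain ⟨y, rfl⟩ := AugQuot.mk_surjective y
      exact AugQuot.mk_eq_zero.2 (mul_mem_pow (m := 2) (n := 1) hx y.2)

variable {ℓ G} in
theorem mulV_mk (x y : ↥(augIdeal ℓ G ^ 1)) :
    mulV ℓ G (AugQuot.mk ℓ G 1 2 x) (AugQuot.mk ℓ G 1 2 y) =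
      AugQuot.mk ℓ G 2 3 ⟨x.1 * y.1, mul_mem_pow x.2 y.2⟩ := rfl

/-- The multiplication map `V ⊗ V → U`. -/
noncomputable def mulTensor : V ℓ G ⊗[ℤ_[ℓ]] V ℓ G →ₗ[ℤ_[ℓ]] U ℓ G :=
  TensorProduct.lift (mulV ℓ G)

/-- The alternating tensors: the `t ∈ V ⊗ V` with `ι t = -t`, where `ι (x ⊗ y) = y ⊗ x`. -/
noncomputable def altTensors : Submodule ℤ_[ℓ] (V ℓ G ⊗[ℤ_[ℓ]] V ℓ G) :=
  LinearMap.eqLocus (TensorProduct.comm ℤ_[ℓ] (V ℓ G) (V ℓ G)).toLinearMap (-LinearMap.id)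

/-- `W ⊆ I²/I³`, the image of the alternating tensors under multiplication. -/
noncomputable def W : Submodule ℤ_[ℓ] (U ℓ G) := (altTensors ℓ G).map (mulTensor ℓ G)

/-- The commutator map `m : V → Hom(V, U)`, `x ↦ (y ↦ xy - yx)`. -/
noncomputable def commutatorMap : V ℓ G →ₗ[ℤ_[ℓ]] V ℓ G →ₗ[ℤ_[ℓ]] U ℓ G :=
  mulV ℓ G - (mulV ℓ G).flip

theorem commutatorMap_apply (x y : V ℓ G) :
    commutatorMap ℓ G x y = mulV ℓ G x y - mulV ℓ G y x := rfl

theorem commutatorMap_mem (x y : V ℓ G) : commutatorMap ℓ G x y ∈ W ℓ G := by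
  refine ⟨x ⊗ₜ y - y ⊗ₜ x, ?_, ?_⟩
  · change TensorProduct.comm _ _ _ (x ⊗ₜ y - y ⊗ₜ x) = -(x ⊗ₜ y - y ⊗ₜ x)
    simp
  · simp [mulTensor, commutatorMap_apply]

/-- The commutator map, with values in `Hom(V, W)`. -/
noncomputable def commutatorMapW : V ℓ G →ₗ[ℤ_[ℓ]] V ℓ G →ₗ[ℤ_[ℓ]] ↥(W ℓ G) :=
  LinearMap.mk₂ ℤ_[ℓ] (fun x y => ⟨commutatorMap ℓ G x y, commutatorMap_mem ℓ G x y⟩)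
    (fun x x' y => Subtype.ext (by simp))
    (fun c x y => Subtype.ext (by simp))
    (fun x y y' => Subtype.ext (by simp))
    (fun c x y => Subtype.ext (by simp))

variable {ℓ G}

theorem augRep_mulV (σ : ContAut G) (x y : V ℓ G) :
    augRep ℓ G 2 3 σ (mulV ℓ G x y) =
      mulV ℓ G (augRep ℓ G 1 2 σ x) (augRep ℓ G 1 2 σ y) := by
  obtain ⟨x, rfl⟩ := AugQuot.mk_surjective x
  obtain ⟨y, rfl⟩ := AugQuot.mk_surjective y
  exact congrArg (AugQuot.mk ℓ G 2 3) (Subtype.ext (map_mul (CompletedGroupRing.map σ) x.1 y.1))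

theorem augRep_W_le (σ : ContAut G) : W ℓ G ≤ (W ℓ G).comap (augRep ℓ G 2 3 σ) := by
  rintro _ ⟨t, ht, rfl⟩
  refine ⟨TensorProduct.map (augRep ℓ G 1 2 σ) (augRep ℓ G 1 2 σ) t, ?_, ?_⟩
  · have ht' : TensorProduct.comm _ _ _ t = -t := ht
    change TensorProduct.comm _ _ _ (TensorProduct.map _ _ t) = -(TensorProduct.map _ _ t)
    rw [← map_neg, ← ht']
    exact (TensorProduct.map_comm _ _ t).symm
  · clear ht
    induction t using TensorProduct.induction_on with
    | zero => simp
    | tmul x y => simp [mulTensor, augRep_mulV]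
    | add a b ha hb => rw [map_add, map_add, map_add, map_add, ha, hb]

/-- Inner automorphisms act trivially on `I^n / I^(n+1)`. -/
theorem augRep_conj [IsTopologicalGroup G] (n : ℕ) (g : G) (x : AugQuot ℓ G n (n + 1)) :
    augRep ℓ G n (n + 1) (conj g) x = x := by
  obtain ⟨x, rfl⟩ := AugQuot.mk_surjective x
  rw [augRep_mk, ← sub_eq_zero, ← map_sub]
  refine AugQuot.mk_eq_zero.2 ?_
  change CompletedGroupRing.map (conj g) x.1 - x.1 ∈ augIdeal ℓ G ^ (n + 1)
  set a := of ℓ g - 1 with ha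
  set b := of ℓ g⁻¹ - 1 with hb
  have hgb : of ℓ g * of ℓ g⁻¹ = 1 := by rw [← map_mul, mul_inv_cancel, map_one]
  have key : CompletedGroupRing.map (conj g) x.1 - x.1 =
      (a * x.1 - x.1 * a) + (a * x.1 - x.1 * a) * b := by
    have h : CompletedGroupRing.map (conj g) x.1 - x.1 =
        of ℓ g * x.1 * of ℓ g⁻¹ - x.1 * (of ℓ g * of ℓ g⁻¹) := by
      rw [hgb, mul_one, map_conj]
    rw [h, ha, hb]
    noncomm_ring
  have hc : a * x.1 - x.1 * a ∈ augIdeal ℓ G ^ (n + 1) := by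
    refine Submodule.sub_mem _ ?_ ?_
    · rw [pow_succ']
      exact Submodule.mul_mem_mul (of_sub_one_mem g) x.2
    · rw [pow_succ]
      exact Submodule.mul_mem_mul x.2 (of_sub_one_mem g)
  rw [key]
  refine Submodule.add_mem _ hc (augIdeal_pow_succ_le n ?_)
  rw [pow_succ]
  exact Submodule.mul_mem_mul hc (of_sub_one_mem g⁻¹)

end Augmentation

/-! ### First continuous cohomology -/

section Cohomology

variable {k Γ Γ' M M' : Type*} [CommRing k]
  [Group Γ] [TopologicalSpace Γ] [Group Γ'] [TopologicalSpace Γ']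
  [AddCommGroup M] [Module k M] [TopologicalSpace M] [IsTopologicalAddGroup M]
  [AddCommGroup M'] [Module k M'] [TopologicalSpace M'] [IsTopologicalAddGroup M']

/-- Continuous 1-cocycles (crossed homomorphisms) `c : Γ → M`, `c (gh) = c g + g (c h)`. -/
def Z1 (ρ : Representation k Γ M) : AddSubgroup (Γ → M) where
  carrier := {c | Continuous c ∧ ∀ g h, c (g * h) = c g + ρ g (c h)}
  zero_mem' := ⟨continuous_const, fun g h => by simp⟩
  add_mem' := by
    rintro a b ⟨ha, ha'⟩ ⟨hb, hb'⟩
    refine ⟨ha.add hb, fun g h => ?_⟩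
    simp only [Pi.add_apply, ha', hb', map_add]
    abel
  neg_mem' := by
    rintro a ⟨ha, ha'⟩
    refine ⟨ha.neg, fun g h => ?_⟩
    simp only [Pi.neg_apply, ha', map_neg]
    abel

/-- The 1-coboundaries `g ↦ g m - m`. -/
def B1 (ρ : Representation k Γ M) : AddSubgroup (Z1 ρ) where
  carrier := {z | ∃ m : M, ∀ g, z.1 g = ρ g m - m}
  zero_mem' := ⟨0, fun g => by simp⟩
  add_mem' := by
    rintro a b ⟨m, hm⟩ ⟨n, hn⟩
    refine ⟨m + n, fun g => ?_⟩
    change a.1 g + b.1 g = _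
    rw [hm, hn, map_add]
    abel
  neg_mem' := by
    rintro a ⟨m, hm⟩
    refine ⟨-m, fun g => ?_⟩
    change -a.1 g = _
    rw [hm, map_neg]
    abel

/-- The first continuous cohomology group `H¹(Γ, M)`: continuous 1-cocycles modulo
1-coboundaries. -/
abbrev H1 (ρ : Representation k Γ M) : Type _ := Z1 ρ ⧸ B1 ρ

/-- The class of a cocycle. -/
def H1.mk {ρ : Representation k Γ M} : Z1 ρ →+ H1 ρ := QuotientAddGroup.mk' (B1 ρ)

/-- Functoriality: a continuous homomorphism `φ : Γ' → Γ` and a continuous `φ`-equivariant map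
`f : M → M'` induce `H¹(Γ, M) → H¹(Γ', M')`, `[c] ↦ [f ∘ c ∘ φ]`. -/
def H1.map (ρ : Representation k Γ M) (ρ' : Representation k Γ' M')
    (φ : Γ' →* Γ) (hφ : Continuous φ) (f : M →ₗ[k] M') (hf : Continuous f)
    (hequiv : ∀ g x, f (ρ (φ g) x) = ρ' g (f x)) : H1 ρ →+ H1 ρ' :=
  QuotientAddGroup.map (B1 ρ) (B1 ρ')
    { toFun := fun z => ⟨fun g => f (z.1 (φ g)), hf.comp (z.2.1.comp hφ), fun g h => by
        change f (z.1 (φ (g * h))) = f (z.1 (φ g)) + ρ' g (f (z.1 (φ h)))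
        rw [map_mul, z.2.2, map_add, hequiv]⟩
      map_zero' := Subtype.ext (funext fun _ => map_zero f)
      map_add' := fun _ _ => Subtype.ext (funext fun _ => map_add f _ _) }
    (by
      rintro z ⟨m, hm⟩
      refine ⟨f m, fun g => ?_⟩
      change f (z.1 (φ g)) = _
      rw [hm, map_sub, hequiv])

end Cohomology

section PointwiseTopology

variable {k M M' : Type*} [CommRing k] [AddCommGroup M] [Module k M] [AddCommGroup M'] [Module k M']
  [TopologicalSpace M']

/-- The topology of pointwise convergence on a module of linear maps. For finitely generated
modules over `ℤ_ℓ` with their profinite topology, it is the profinite topology on `Hom`. -/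
instance : TopologicalSpace (M →ₗ[k] M') :=
  TopologicalSpace.induced (fun f x => f x) inferInstance

instance [IsTopologicalAddGroup M'] : IsTopologicalAddGroup (M →ₗ[k] M') :=
  topologicalAddGroup_induced
    ({ toFun := fun f x => f x, map_zero' := rfl, map_add' := fun _ _ => rfl } :
      (M →ₗ[k] M') →+ (M → M'))

theorem continuous_linearMap_apply (x : M) : Continuous fun f : M →ₗ[k] M' => f x :=
  (continuous_apply x).comp continuous_induced_dom

end PointwiseTopology

/-! ### The coefficient modules -/

section Coefficients

variable (ℓ : ℕ) [Fact ℓ.Prime]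
variable (G : Type u) [Group G] [TopologicalSpace G]

/-- `Hom(V, U) = Hom(I/I², I²/I³)`. -/
abbrev HomVU : Type u := V ℓ G →ₗ[ℤ_[ℓ]] U ℓ G

/-- `Hom(V, W)`. -/
abbrev HomVW : Type u := V ℓ G →ₗ[ℤ_[ℓ]] ↥(W ℓ G)

/-- `A(G)`, the cokernel of the commutator map `V → Hom(V, U)`. -/
abbrev A : Type u := HomVU ℓ G ⧸ LinearMap.range (commutatorMap ℓ G)

/-- `A_W(G)`, the cokernel of the commutator map `V → Hom(V, W)`. -/
abbrev AW : Type u := HomVW ℓ G ⧸ LinearMap.range (commutatorMapW ℓ G)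

/-- The action of `Aut(G)` on `Hom(V, U)`, `(σ f)(v) = σ (f (σ⁻¹ v))`. -/
noncomputable def repHomVU : Representation ℤ_[ℓ] (ContAut G) (HomVU ℓ G) :=
  (augRep ℓ G 1 2).linHom (augRep ℓ G 2 3)

/-- The action of `Aut(G)` on `W`. -/
noncomputable def repW : Representation ℤ_[ℓ] (ContAut G) ↥(W ℓ G) :=
  (augRep ℓ G 2 3).subrepresentation (W ℓ G) augRep_W_le

/-- The action of `Aut(G)` on `Hom(V, W)`. -/
noncomputable def repHomVW : Representation ℤ_[ℓ] (ContAut G) (HomVW ℓ G) :=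
  (augRep ℓ G 1 2).linHom (repW ℓ G)

/-- The inclusion `Hom(V, W) → Hom(V, U)`. -/
noncomputable def inclHom : HomVW ℓ G →ₗ[ℤ_[ℓ]] HomVU ℓ G where
  toFun f := (W ℓ G).subtype ∘ₗ f
  map_add' _ _ := rfl
  map_smul' _ _ := rfl

variable {ℓ G}

theorem repHomVU_apply (σ : ContAut G) (f : HomVU ℓ G) (v : V ℓ G) :
    repHomVU ℓ G σ f v = augRep ℓ G 2 3 σ (f (augRep ℓ G 1 2 σ⁻¹ v)) := rfl

theorem repHomVW_apply (σ : ContAut G) (f : HomVW ℓ G) (v : V ℓ G) :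
    (repHomVW ℓ G σ f v : U ℓ G) = augRep ℓ G 2 3 σ (f (augRep ℓ G 1 2 σ⁻¹ v)) := rfl

theorem inclHom_rep (σ : ContAut G) (f : HomVW ℓ G) :
    inclHom ℓ G (repHomVW ℓ G σ f) = repHomVU ℓ G σ (inclHom ℓ G f) := rfl

theorem repHomVU_commutatorMap (σ : ContAut G) (x : V ℓ G) :
    repHomVU ℓ G σ (commutatorMap ℓ G x) = commutatorMap ℓ G (augRep ℓ G 1 2 σ x) := by
  refine LinearMap.ext fun v => ?_
  have h : augRep ℓ G 1 2 σ (augRep ℓ G 1 2 σ⁻¹ v) = v := by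
    rw [← Module.End.mul_apply, ← map_mul, mul_inv_cancel, map_one, Module.End.one_apply]
  rw [repHomVU_apply, commutatorMap_apply, commutatorMap_apply, map_sub, augRep_mulV, augRep_mulV,
    h]

theorem repHomVW_commutatorMapW (σ : ContAut G) (x : V ℓ G) :
    repHomVW ℓ G σ (commutatorMapW ℓ G x) = commutatorMapW ℓ G (augRep ℓ G 1 2 σ x) :=
  LinearMap.ext fun v => Subtype.ext
    (LinearMap.congr_fun (repHomVU_commutatorMap σ x) v)

theorem inclHom_commutatorMapW (x : V ℓ G) :
    inclHom ℓ G (commutatorMapW ℓ G x) = commutatorMap ℓ G x := rfl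

variable (ℓ G)

/-- The action of `Aut(G)` on `A(G)`. -/
noncomputable def repA : Representation ℤ_[ℓ] (ContAut G) (A ℓ G) :=
  (repHomVU ℓ G).quotient _ (by
    rintro σ _ ⟨x, rfl⟩
    exact ⟨_, (repHomVU_commutatorMap σ x).symm⟩)

/-- The action of `Aut(G)` on `A_W(G)`. -/
noncomputable def repAW : Representation ℤ_[ℓ] (ContAut G) (AW ℓ G) :=
  (repHomVW ℓ G).quotient _ (by
    rintro σ _ ⟨x, rfl⟩
    exact ⟨_, (repHomVW_commutatorMapW σ x).symm⟩)

/-- The map `A_W(G) → A(G)` induced by the inclusion `Hom(V, W) → Hom(V, U)`. -/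
noncomputable def inclA : AW ℓ G →ₗ[ℤ_[ℓ]] A ℓ G :=
  Submodule.mapQ _ _ (inclHom ℓ G) (by
    rintro _ ⟨x, rfl⟩
    exact ⟨x, rfl⟩)

variable {ℓ G}

theorem inclA_rep (σ : ContAut G) (x : AW ℓ G) :
    inclA ℓ G (repAW ℓ G σ x) = repA ℓ G σ (inclA ℓ G x) := by
  induction x using Submodule.Quotient.induction_on with
  | H f => rfl

theorem continuous_inclHom : Continuous (inclHom ℓ G) :=
  continuous_induced_rng.2 <| continuous_pi fun v =>
    continuous_subtype_val.comp (continuous_linearMap_apply v)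

theorem continuous_inclA : Continuous (inclA ℓ G) :=
  continuous_quot_lift _ (continuous_quot_mk.comp continuous_inclHom)

variable [IsTopologicalGroup G]

/-! Inner automorphisms act trivially on all these modules, which makes them `Out(G)`-modules. -/

theorem repHomVU_inner (s : Inn G) (f : HomVU ℓ G) : repHomVU ℓ G s.1 f = f := by
  obtain ⟨_, ⟨g, rfl⟩⟩ := s
  refine LinearMap.ext fun v => ?_
  change augRep ℓ G 2 3 (conj g) (f (augRep ℓ G 1 2 (conj g)⁻¹ v)) = f v
  rw [← map_inv, augRep_conj 1, augRep_conj 2]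

theorem repHomVW_inner (s : Inn G) (f : HomVW ℓ G) : repHomVW ℓ G s.1 f = f :=
  LinearMap.ext fun v => Subtype.ext
    (LinearMap.congr_fun (repHomVU_inner s (inclHom ℓ G f)) v)

instance : Representation.IsTrivial ((repHomVU ℓ G).comp (Inn G).subtype) :=
  ⟨fun s => LinearMap.ext (repHomVU_inner s)⟩

instance : Representation.IsTrivial ((repA ℓ G).comp (Inn G).subtype) :=
  ⟨fun s => LinearMap.ext fun x => by
    induction x using Submodule.Quotient.induction_on with
    | H f => exact congrArg Submodule.Quotient.mk (repHomVU_inner s f)⟩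

instance : Representation.IsTrivial ((repAW ℓ G).comp (Inn G).subtype) :=
  ⟨fun s => LinearMap.ext fun x => by
    induction x using Submodule.Quotient.induction_on with
    | H f => exact congrArg Submodule.Quotient.mk (repHomVW_inner s f)⟩

variable (ℓ G)

/-- The action of `Out(G)` on `Hom(V, U)`. -/
noncomputable def repHomVUOut : Representation ℤ_[ℓ] (ContOut G) (HomVU ℓ G) :=
  (repHomVU ℓ G).ofQuotient (Inn G)

/-- The action of `Out(G)` on `A(G)`. -/
noncomputable def repAOut : Representation ℤ_[ℓ] (ContOut G) (A ℓ G) :=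
  (repA ℓ G).ofQuotient (Inn G)

/-- The action of `Out(G)` on `A_W(G)`. -/
noncomputable def repAWOut : Representation ℤ_[ℓ] (ContOut G) (AW ℓ G) :=
  (repAW ℓ G).ofQuotient (Inn G)

end Coefficients

/-! ### The modified diagonal class and the Johnson class -/

section Classes

variable (ℓ : ℕ) [Fact ℓ.Prime]
variable (G : Type u) [Group G] [TopologicalSpace G]

/-- `H¹(Aut(G), Hom(V, W)) → H¹(Aut(G), Hom(V, U))`. -/
noncomputable def coeffMapAut : H1 (repHomVW ℓ G) →+ H1 (repHomVU ℓ G) :=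
  H1.map _ _ (MonoidHom.id _) continuous_id (inclHom ℓ G) continuous_inclHom inclHom_rep

/-- `H¹(Aut(G), Hom(V, U)) → H¹(Aut(G), A(G))`. -/
noncomputable def toAAut : H1 (repHomVU ℓ G) →+ H1 (repA ℓ G) :=
  H1.map _ _ (MonoidHom.id _) continuous_id
    (LinearMap.range (commutatorMap ℓ G)).mkQ continuous_quot_mk fun _ _ => rfl

/-- `c` is the class in `H¹(Aut(G), Hom(V, U))` of the extension
`0 → I²/I³ → I/I³ → I/I² → 0`: for some `ℤ_ℓ`-linear section `s` of `I/I³ → I/I²`, it is the class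
of the cocycle `σ ↦ σ ∘ s ∘ σ⁻¹ - s`, which takes values in `Hom(I/I², I²/I³)`. -/
def IsModifiedDiagonalClass (c : H1 (repHomVU ℓ G)) : Prop :=
  ∃ (s : V ℓ G →ₗ[ℤ_[ℓ]] E ℓ G) (z : Z1 (repHomVU ℓ G)),
    (∀ v, projEV ℓ G (s v) = v) ∧
    (∀ σ v, inclUE ℓ G (z.1 σ v) = augRep ℓ G 1 3 σ (s (augRep ℓ G 1 2 σ⁻¹ v)) - s v) ∧
    H1.mk z = c

variable [IsTopologicalGroup G]

/-- `H¹(Out(G), A_W(G)) → H¹(Out(G), A(G))`. -/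
noncomputable def coeffMapOut : H1 (repAWOut ℓ G) →+ H1 (repAOut ℓ G) :=
  H1.map _ _ (MonoidHom.id _) continuous_id (inclA ℓ G) continuous_inclA fun g x => by
    induction g using QuotientGroup.induction_on with
    | H σ => exact inclA_rep σ x

/-- The inflation map `H¹(Out(G), A(G)) → H¹(Aut(G), A(G))`. -/
noncomputable def inflation : H1 (repAOut ℓ G) →+ H1 (repA ℓ G) :=
  H1.map _ _ (QuotientGroup.mk' (Inn G)) continuous_quot_mk LinearMap.id continuous_id
    fun _ _ => rfl

/-- `j` is a Johnson class: its inflation in `H¹(Aut(G), A(G))` is the image of the modified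
diagonal class. -/
def IsJohnsonClass (j : H1 (repAOut ℓ G)) : Prop :=
  ∃ c, IsModifiedDiagonalClass ℓ G c ∧ inflation ℓ G j = toAAut ℓ G c

end Classes

/-- The vanishing `H⁰(Γ, M ⊗ ℤ_ℓ/2) = 0`, with `Γ` acting through `M`. -/
def H0ModTwoVanishes (ℓ : ℕ) [Fact ℓ.Prime] {Γ M : Type*} [Group Γ] [AddCommGroup M]
    [Module ℤ_[ℓ] M] (ρ : Representation ℤ_[ℓ] Γ M) : Prop :=
  (ρ.tprod (Representation.trivial ℤ_[ℓ] Γ (ℤ_[ℓ] ⧸ Ideal.span {(2 : ℤ_[ℓ])}))).invariants = ⊥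

end ProEll

namespace ProEll

open CompletedGroupRing Topology commutatorElement

/-! ### The topology of the completed group ring -/

section Topology

variable {ℓ : ℕ} [Fact ℓ.Prime] {G : Type u} [Group G] [TopologicalSpace G]

/-! Let `σ` act by `-1` on the abelianization. Since `V` is generated by the classes of `[g] - 1`
and `U` by products of two elements of `V`, `σ` is `-1` on `V`, `1` on `U` and hence `-1` on `Hom(V,
U)`. The argument is the usual one by which a central `-1` kills twice a class, except that `σ` is
central only modulo `W`.

Lifting. Every conjugate `τ σ τ⁻¹` also inverts the abelianization, so `σ g` and `τ σ τ⁻¹ g` differ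
by an element `c` of the closed commutator subgroup. For such `c` one has `[c] - 1 ∈ W + I³`,
because `[⁅a, b⁆] - 1 ≡ xy - yx` modulo `I³` with `x = [a] - 1`, `y = [b] - 1`
(`of_sub_one_mem_preimageW`). Hence `σ` and `τ σ τ⁻¹` agree on `E` modulo `W`
(`ActsByInversion.augRep_sub_mem`). For a section `s` with cocycle `z`, the map `t = s + σ s` has
values in `U`, and `2z` minus the coboundary of `t` is exactly the difference of these two actions,
so it is `W`-valued (`ActsByInversion.exists_coboundary`). Thus twice the class lifts, and doubling
the lift gives the statement with `4`.

Uniqueness. If a `W`-valued cocycle is the coboundary of `f ∈ Hom(V, U)`, evaluation at `σ` gives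
`-2f ∈ Hom(V, W)`. It remains to see that `U / W` has no `2`-torsion (`mem_W_of_two_smul_mem`). For
functionals `a`, `b` on `V`, the product `ab` is a quadratic function on `G`; extended linearly it
kills `I³` and sends `([g] - 1)([h] - 1)` to `a(g)b(h) + a(h)b(g)`. So the symmetrization of a
tensor is determined by its image in `U`, and when `V` is free it vanishes as soon as its double
does.

Freeness of `V` also provides `s`. It holds because `G → V` is onto with kernel the closed
commutator subgroup, so `V` is a finitely generated torsion-free `ℤ_ℓ`-module.

Outer classes. On the inner automorphism by `g`, the cocycle `z` is the commutator map at `[g] - 1`,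
and coboundaries vanish there. So the cocycles with values in `A(G)` and `A_W(G)` descend to
`Out(G)`, and inflation is injective.

The topological input is that the algebraic powers of `I` are closed (`isClosed_augIdeal_pow`); this
makes the subquotients Hausdorff and the cocycles continuous. -/

instance finite_quotient [IsTopologicalGroup G] [CompactSpace G] (N : OpenNormalSubgroup G) :
    Finite (G ⧸ N.toSubgroup) :=
  Subgroup.quotient_finite_of_isOpen _ N.isOpen'

theorem CompletedGroupRing.isInducing_coeffHom :
    IsInducing (coeffHom (ℓ := ℓ) (G := G)) := ⟨rfl⟩

theorem CompletedGroupRing.coeffHom_injective :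
    Function.Injective (coeffHom (ℓ := ℓ) (G := G)) := fun _ _ h =>
  CompletedGroupRing.ext fun N => MonoidAlgebra.coeff_injective
    (Finsupp.ext fun q => congrFun (congrFun h N) q)

instance : T2Space (CompletedGroupRing ℓ G) :=
  T2Space.of_injective_continuous coeffHom_injective isInducing_coeffHom.continuous

theorem CompletedGroupRing.continuous_coeff_proj (N : OpenNormalSubgroup G)
    (q : G ⧸ N.toSubgroup) :
    Continuous fun x : CompletedGroupRing ℓ G => (proj ℓ N x).coeff q :=
  continuous_pi_iff.1 (continuous_pi_iff.1 isInducing_coeffHom.continuous N) q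

theorem CompletedGroupRing.continuous_rng {X : Type*} [TopologicalSpace X]
    {f : X → CompletedGroupRing ℓ G}
    (h : ∀ (N : OpenNormalSubgroup G) (q : G ⧸ N.toSubgroup),
      Continuous fun x => (proj ℓ N (f x)).coeff q) : Continuous f :=
  isInducing_coeffHom.continuous_iff.2 (continuous_pi fun N => continuous_pi fun q => h N q)

instance : ContinuousSMul ℤ_[ℓ] (CompletedGroupRing ℓ G) where
  continuous_smul := continuous_rng fun N q => by
    simp only [map_smul, MonoidAlgebra.coeff_smul_apply]
    exact continuous_fst.smul ((continuous_coeff_proj N q).comp continuous_snd)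

/-- The linear identification of `R[M]` with functions on the finite monoid `M`. -/
noncomputable def coeffLinearEquiv (R M : Type*) [CommSemiring R] [Finite M] :
    MonoidAlgebra R M ≃ₗ[R] (M → R) :=
  (MonoidAlgebra.coeffLinearEquiv R).trans (Finsupp.linearEquivFunOnFinite R R M)

theorem coeffLinearEquiv_apply {R M : Type*} [CommSemiring R] [Finite M] (x : MonoidAlgebra R M)
    (m : M) : coeffLinearEquiv R M x m = x.coeff m := rfl

/-- The coefficient at `m`, as a linear map. -/
noncomputable def coeffLinear (R : Type*) {M : Type*} [CommSemiring R] (m : M) :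
    MonoidAlgebra R M →ₗ[R] R where
  toFun x := x.coeff m
  map_add' _ _ := rfl
  map_smul' _ _ := rfl

theorem CompletedGroupRing.continuous_of [IsTopologicalGroup G] :
    Continuous (of ℓ : G → CompletedGroupRing ℓ G) :=
  continuous_rng fun N q => by
    have : DiscreteTopology (G ⧸ N.toSubgroup) := QuotientGroup.discreteTopology N.isOpen'
    exact (continuous_of_discreteTopology (f := fun p : G ⧸ N.toSubgroup =>
      (MonoidAlgebra.single p (1 : ℤ_[ℓ])).coeff q)).comp continuous_quot_mk

variable [IsTopologicalGroup G] [CompactSpace G]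

/-- Compactness makes `G ⧸ N` finite, so a linear map on `ℤ_ℓ[G/N]` is a linear map on some `ℤ_ℓ^n`
and is automatically continuous. Multiplications, augmentation and the maps induced by automorphisms
all get their continuity from this. -/
theorem CompletedGroupRing.continuous_linear_proj {F : Type*} [AddCommGroup F] [Module ℤ_[ℓ] F]
    [TopologicalSpace F] [ContinuousAdd F] [ContinuousSMul ℤ_[ℓ] F]
    (N : OpenNormalSubgroup G) (f : MonoidAlgebra ℤ_[ℓ] (G ⧸ N.toSubgroup) →ₗ[ℤ_[ℓ]] F) :
    Continuous fun x : CompletedGroupRing ℓ G => f (proj ℓ N x) := by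
  have h := LinearMap.continuous_on_pi
    (f ∘ₗ (coeffLinearEquiv ℤ_[ℓ] (G ⧸ N.toSubgroup)).symm.toLinearMap)
  have h' : Continuous fun x : CompletedGroupRing ℓ G =>
      coeffLinearEquiv ℤ_[ℓ] (G ⧸ N.toSubgroup) (proj ℓ N x) :=
    continuous_pi fun q => continuous_coeff_proj N q
  exact (h.comp h').congr fun x => congrArg f (LinearEquiv.symm_apply_apply _ _)

/-- Compatibility of a family is a system of equations between continuous functions of its
coefficients. With the product of copies of the compact ring `ℤ_ℓ` as ambient space, this gives
compactness of `ℤ_ℓ[[G]]`. -/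
theorem isClosed_range_coeffHom : IsClosed (Set.range (coeffHom (ℓ := ℓ) (G := G))) := by
  have h : Set.range (coeffHom (ℓ := ℓ) (G := G)) =
      {f | ∀ (N M : OpenNormalSubgroup G)
        (h : ∀ g ∈ N.toSubgroup, MonoidHom.id G g ∈ M.toSubgroup) (q : G ⧸ M.toSubgroup),
        (transition ℓ (MonoidHom.id G) h ((coeffLinearEquiv _ _).symm (f N))).coeff q = f M q} := by
    ext f
    constructor
    · rintro ⟨x, rfl⟩ N M h q
      have e : (coeffLinearEquiv ℤ_[ℓ] (G ⧸ N.toSubgroup)).symm (coeffHom x N) = proj ℓ N x :=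
        (LinearEquiv.symm_apply_eq _).2 rfl
      rw [e, transition_proj]
      rfl
    · intro hf
      refine ⟨⟨fun N => (coeffLinearEquiv _ _).symm (f N), fun N M h =>
        (coeffLinearEquiv _ _).injective (funext fun q => ?_)⟩, ?_⟩
      · rw [coeffLinearEquiv_apply, hf N M h q, LinearEquiv.apply_symm_apply]
      · exact funext fun N => LinearEquiv.apply_symm_apply (coeffLinearEquiv _ _) (f N)
  rw [h]
  simp only [Set.ofPred_forall]
  refine isClosed_iInter fun N => isClosed_iInter fun M => isClosed_iInter fun h =>
    isClosed_iInter fun q => isClosed_eq ?_ ((continuous_apply q).comp (continuous_apply M))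
  exact (LinearMap.continuous_on_pi (coeffLinear ℤ_[ℓ] q ∘ₗ
    (transition ℓ (MonoidHom.id G) h).toLinearMap ∘ₗ
    (coeffLinearEquiv ℤ_[ℓ] (G ⧸ N.toSubgroup)).symm.toLinearMap)).comp (continuous_apply N)

instance : CompactSpace (CompletedGroupRing ℓ G) :=
  (IsClosedEmbedding.mk ⟨isInducing_coeffHom, coeffHom_injective⟩
    isClosed_range_coeffHom).compactSpace

theorem CompletedGroupRing.continuous_mul_right (a : CompletedGroupRing ℓ G) :
    Continuous fun x : CompletedGroupRing ℓ G => x * a :=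
  continuous_rng fun N q => by
    simp only [map_mul]
    exact continuous_linear_proj N (coeffLinear ℤ_[ℓ] q ∘ₗ LinearMap.mulRight ℤ_[ℓ] (proj ℓ N a))

theorem continuous_augmentation : Continuous (augmentation ℓ G) :=
  continuous_linear_proj (wholeGroup G)
    (MonoidAlgebra.lift ℤ_[ℓ] ℤ_[ℓ] (G ⧸ (wholeGroup G).toSubgroup) 1).toLinearMap

theorem CompletedGroupRing.continuous_map (σ : ContAut G) :
    Continuous (CompletedGroupRing.map σ : CompletedGroupRing ℓ G → CompletedGroupRing ℓ G) :=
  continuous_rng fun N q => by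
    simp only [proj_map]
    exact continuous_linear_proj (pullback σ N) (coeffLinear ℤ_[ℓ] q ∘ₗ
      (transition ℓ (σ : G →* G) (pullback_le σ N)).toLinearMap)

end Topology

/-! ### Continuity of the action of `Aut(G)` -/

section Action

variable {ℓ : ℕ} [Fact ℓ.Prime] {G : Type u} [Group G] [TopologicalSpace G]

theorem transition_congr {φ ψ : G →* G} {N M : OpenNormalSubgroup G}
    (hφ : ∀ g ∈ N.toSubgroup, φ g ∈ M.toSubgroup) (hψ : ∀ g ∈ N.toSubgroup, ψ g ∈ M.toSubgroup)
    (h : ∀ g, (φ g)⁻¹ * ψ g ∈ M.toSubgroup) (x : MonoidAlgebra ℤ_[ℓ] (G ⧸ N.toSubgroup)) :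
    transition ℓ φ hφ x = transition ℓ ψ hψ x := by
  induction x using MonoidAlgebra.induction_linear with
  | zero => simp
  | add a b ha hb => rw [map_add, map_add, ha, hb]
  | single q a =>
    induction q using QuotientGroup.induction_on with
    | H y =>
      rw [transition_single, transition_single]
      congr 1
      exact QuotientGroup.eq.2 (h y)

/-- Automorphisms that agree modulo `N` act equally on `ℤ_ℓ[G/N]`. -/
theorem proj_map_congr {σ τ : ContAut G} {N : OpenNormalSubgroup G}
    (h : ∀ g, (σ g)⁻¹ * τ g ∈ N.toSubgroup) (x : CompletedGroupRing ℓ G) :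
    proj ℓ N (CompletedGroupRing.map σ x) = proj ℓ N (CompletedGroupRing.map τ x) := by
  have h1 : ∀ g ∈ (pullback σ N).toSubgroup, (τ : G →* G) g ∈ N.toSubgroup := fun g hg => by
    have := N.toSubgroup.mul_mem (show σ g ∈ N.toSubgroup from hg) (h g)
    rwa [mul_inv_cancel_left] at this
  have h2 : ∀ g ∈ (pullback σ N).toSubgroup, MonoidHom.id G g ∈ (pullback τ N).toSubgroup := h1
  rw [proj_map, proj_map, ← transition_proj x h2, transition_transition ℓ _ _ _ _ h1]
  exact transition_congr _ _ h _

variable [IsTopologicalGroup G] [CompactSpace G]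

/-- The finitely many cosets `K q` of `σ⁻¹(N)` are compact, and `σ` sends each into the open coset
`O q` of `N`. Asking the same of `τ` is a compact-open condition, and it forces `τ ≡ σ` modulo `N`
everywhere. -/
theorem setOf_congr_mod_mem_nhds (σ : ContAut G) (N : OpenNormalSubgroup G) :
    {τ : ContAut G | ∀ g, (σ g)⁻¹ * τ g ∈ N.toSubgroup} ∈ 𝓝 σ := by
  have hind : IsInducing (fun τ : ContAut G => (⟨τ, τ.continuous⟩ : C(G, G))) := ⟨rfl⟩
  let K (q : G ⧸ (pullback σ N).toSubgroup) : Set G :=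
    (QuotientGroup.mk : G → G ⧸ (pullback σ N).toSubgroup) ⁻¹' {q}
  let O (q : G ⧸ (pullback σ N).toSubgroup) : Set G := {y | (σ q.out)⁻¹ * y ∈ N.toSubgroup}
  have hdisc : DiscreteTopology (G ⧸ (pullback σ N).toSubgroup) :=
    QuotientGroup.discreteTopology (pullback σ N).isOpen'
  have hK (q) : IsCompact (K q) :=
    ((isClosed_discrete {q}).preimage continuous_quot_mk).isCompact
  have hO (q) : IsOpen (O q) := N.isOpen'.preimage (continuous_const_mul _)
  have hσ {g : G} {q} (hg : g ∈ K q) : (σ q.out)⁻¹ * σ g ∈ N.toSubgroup := by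
    have h : ((q.out : G) : G ⧸ (pullback σ N).toSubgroup) = (g : G) := by
      rw [QuotientGroup.out_eq']
      exact (show (g : G ⧸ (pullback σ N).toSubgroup) = q from hg).symm
    have h' : σ (q.out⁻¹ * g) ∈ N.toSubgroup := QuotientGroup.eq.1 h
    rwa [map_mul, map_inv] at h'
  have hopen : IsOpen (⋂ q, {f : C(G, G) | Set.MapsTo f (K q) (O q)}) :=
    isOpen_iInter_of_finite fun q => ContinuousMap.isOpen_setOfPred_mapsTo (hK q) (hO q)
  refine Filter.mem_of_superset ((hopen.preimage hind.continuous).mem_nhds ?_) ?_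
  · exact Set.mem_iInter.2 fun q g hg => hσ hg
  · intro τ hτ g
    have h1 : (σ (Quotient.out (g : G ⧸ (pullback σ N).toSubgroup)))⁻¹ * τ g ∈ N.toSubgroup :=
      Set.mem_iInter.1 hτ (g : G ⧸ (pullback σ N).toSubgroup) rfl
    have h2 := hσ (show g ∈ K (g : G ⧸ (pullback σ N).toSubgroup) from rfl)
    have h3 := N.toSubgroup.mul_mem (N.toSubgroup.inv_mem h2) h1
    rwa [mul_inv_rev, inv_inv, mul_assoc, mul_inv_cancel_left] at h3

theorem setOf_inv_congr_mod_mem_nhds (σ : ContAut G) (N : OpenNormalSubgroup G) :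
    {τ : ContAut G | ∀ g, (σ⁻¹ g)⁻¹ * τ⁻¹ g ∈ N.toSubgroup} ∈ 𝓝 σ := by
  -- `pullback σ⁻¹ N` is `σ(N)`. The congruence `τ ≡ σ` modulo `σ(N)` is evaluated at `τ⁻¹ g` and
  -- then moved by `σ⁻¹`.
  filter_upwards [setOf_congr_mod_mem_nhds σ (pullback σ⁻¹ N)] with τ hτ g
  have h : σ⁻¹ ((σ (τ⁻¹ g))⁻¹ * τ (τ⁻¹ g)) ∈ N.toSubgroup := hτ (τ⁻¹ g)
  rw [ContAut.apply_inv_apply, map_mul, map_inv, ← ContAut.mul_apply σ⁻¹ σ, inv_mul_cancel,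
    ContAut.one_apply] at h
  have h' := N.toSubgroup.inv_mem h
  rwa [mul_inv_rev, inv_inv] at h'

/-- At each finite level the action is locally constant in the automorphism, so joint continuity
reduces to continuity of one fixed map. It is applied with `f` the identity and with `f` the
inversion. -/
theorem continuous_action_aux {f : ContAut G → ContAut G}
    (hf : ∀ (σ : ContAut G) (N : OpenNormalSubgroup G),
      {τ : ContAut G | ∀ g, (f σ g)⁻¹ * f τ g ∈ N.toSubgroup} ∈ 𝓝 σ) :
    Continuous fun p : ContAut G × CompletedGroupRing ℓ G =>
      CompletedGroupRing.map (f p.1) p.2 := by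
  refine continuous_rng fun N q => continuous_iff_continuousAt.2 fun ⟨σ, x⟩ => ?_
  have h : Continuous fun p : ContAut G × CompletedGroupRing ℓ G =>
      (proj ℓ N (CompletedGroupRing.map (f σ) p.2)).coeff q :=
    (continuous_coeff_proj N q).comp ((continuous_map (f σ)).comp continuous_snd)
  refine h.continuousAt.congr ?_
  filter_upwards [continuousAt_fst (hf σ N)] with p hp
  rw [proj_map_congr hp]

theorem CompletedGroupRing.continuous_action :
    Continuous fun p : ContAut G × CompletedGroupRing ℓ G => CompletedGroupRing.map p.1 p.2 :=
  continuous_action_aux (f := id) setOf_congr_mod_mem_nhds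

theorem CompletedGroupRing.continuous_action_inv :
    Continuous fun p : ContAut G × CompletedGroupRing ℓ G => CompletedGroupRing.map p.1⁻¹ p.2 :=
  continuous_action_aux setOf_inv_congr_mod_mem_nhds

variable (ℓ)

theorem continuous_augRep (m n : ℕ) :
    Continuous fun p : ContAut G × AugQuot ℓ G m n => augRep ℓ G m n p.1 p.2 := by
  have hq : IsOpenQuotientMap (AugQuot.mk ℓ G m n) :=
    QuotientAddGroup.isOpenQuotientMap_mk (N := ((augIdeal ℓ G ^ n).submoduleOf
      (augIdeal ℓ G ^ m)).toAddSubgroup)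
  -- Openness of the quotient map is what makes its product with the identity of `Aut(G)` again a
  -- quotient map.
  rw [((IsOpenQuotientMap.id (X := ContAut G)).prodMap hq).isQuotientMap.continuous_iff]
  refine hq.continuous.comp (Continuous.subtype_mk (continuous_action.comp
    (continuous_fst.prodMk (continuous_subtype_val.comp continuous_snd))) _)

theorem continuous_augRep_inv (m n : ℕ) (x : AugQuot ℓ G m n) :
    Continuous fun σ : ContAut G => augRep ℓ G m n σ⁻¹ x := by
  obtain ⟨x, rfl⟩ := AugQuot.mk_surjective x
  have hq : Continuous (AugQuot.mk ℓ G m n) := continuous_quot_mk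
  exact hq.comp (Continuous.subtype_mk (continuous_action_inv.comp
    (continuous_id.prodMk continuous_const)) _)

end Action

/-! ### Finitely generated topological modules over `ℤ_ℓ` -/

section PadicModules

variable {ℓ : ℕ} [Fact ℓ.Prime] {M F : Type*}
  [AddCommGroup M] [Module ℤ_[ℓ] M] [TopologicalSpace M] [IsTopologicalAddGroup M]
  [ContinuousSMul ℤ_[ℓ] M] [T2Space M]
  [AddCommGroup F] [Module ℤ_[ℓ] F] [TopologicalSpace F] [IsTopologicalAddGroup F]
  [ContinuousSMul ℤ_[ℓ] F]

/-- A surjection from the compact module `ℤ_ℓ^n` onto a Hausdorff one is closed, hence a quotient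
map, and linear maps out of `ℤ_ℓ^n` are continuous. -/
theorem continuous_linearMap_of_finite [Module.Finite ℤ_[ℓ] M] (f : M →ₗ[ℤ_[ℓ]] F) :
    Continuous f := by
  obtain ⟨n, π, hπ⟩ := Module.Finite.exists_fin' ℤ_[ℓ] M
  have hc : Continuous π := LinearMap.continuous_on_pi π
  exact (hc.isClosedMap.isQuotientMap hc hπ).continuous_iff.2
    (LinearMap.continuous_on_pi (f ∘ₗ π))

theorem isClosed_of_fg {P : Submodule ℤ_[ℓ] M} (hP : P.FG) : IsClosed (P : Set M) := by
  have : Module.Finite ℤ_[ℓ] P := Module.Finite.iff_fg.2 hP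
  obtain ⟨n, π, hπ⟩ := Module.Finite.exists_fin' ℤ_[ℓ] P
  have hc : Continuous (P.subtype ∘ₗ π) := LinearMap.continuous_on_pi _
  have hr : Set.range (P.subtype ∘ₗ π) = P := by
    ext x
    constructor
    · rintro ⟨y, rfl⟩
      exact (π y).2
    · intro hx
      obtain ⟨y, hy⟩ := hπ ⟨x, hx⟩
      exact ⟨y, congrArg Subtype.val hy⟩
  rw [← hr]
  exact (isCompact_range hc).isClosed

end PadicModules

/-! ### Powers of the augmentation ideal -/

/-- Topologically finitely generated groups. -/
class TopologicallyFG (G : Type*) [Group G] [TopologicalSpace G] [IsTopologicalGroup G] :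
    Prop where
  out : ∃ S : Finset G, (Subgroup.closure (S : Set G)).topologicalClosure = ⊤

section Generators

variable (ℓ : ℕ) [Fact ℓ.Prime] {G : Type u} [Group G] [TopologicalSpace G]

/-- The map `Λ^S → Λ`, `y ↦ ∑ y_s ([s] - 1)`. -/
noncomputable def generatorMap (S : Finset G) :
    (S → CompletedGroupRing ℓ G) →ₗ[ℤ_[ℓ]] CompletedGroupRing ℓ G where
  toFun y := ∑ s, y s * (of ℓ s.1 - 1)
  map_add' x y := by simp [add_mul, Finset.sum_add_distrib]
  map_smul' c x := by simp [Finset.smul_sum]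

variable {ℓ}

theorem generatorMap_apply (S : Finset G) (y : S → CompletedGroupRing ℓ G) :
    generatorMap ℓ S y = ∑ s, y s * (of ℓ s.1 - 1) := rfl

theorem mul_mem_range_generatorMap {S : Finset G} (a : CompletedGroupRing ℓ G)
    {x : CompletedGroupRing ℓ G} (hx : x ∈ LinearMap.range (generatorMap ℓ S)) :
    a * x ∈ LinearMap.range (generatorMap ℓ S) := by
  obtain ⟨y, rfl⟩ := hx
  exact ⟨fun s => a * y s, by simp [generatorMap_apply, Finset.mul_sum, mul_assoc]⟩

theorem lift_one_proj (N : OpenNormalSubgroup G) (x : CompletedGroupRing ℓ G) :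
    MonoidAlgebra.lift ℤ_[ℓ] ℤ_[ℓ] (G ⧸ N.toSubgroup) 1 (proj ℓ N x) = augmentation ℓ G x := by
  have h : ∀ g ∈ N.toSubgroup, MonoidHom.id G g ∈ (wholeGroup G).toSubgroup := fun _ _ => trivial
  rw [← lift_transition _ h, transition_proj]
  rfl

theorem proj_mem_of_augIdeal {J : Submodule ℤ_[ℓ] (CompletedGroupRing ℓ G)}
    (hJ : ∀ g, of ℓ g - 1 ∈ J) {x : CompletedGroupRing ℓ G} (hx : x ∈ augIdeal ℓ G)
    (N : OpenNormalSubgroup G) : proj ℓ N x ∈ J.map (proj ℓ N).toLinearMap := by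
  -- In a group algebra, `z` minus its augmentation is a linear combination of the elements `[g] -
  -- 1`.
  have key (z : MonoidAlgebra ℤ_[ℓ] (G ⧸ N.toSubgroup)) :
      z - MonoidAlgebra.single 1 (MonoidAlgebra.lift ℤ_[ℓ] ℤ_[ℓ] (G ⧸ N.toSubgroup) 1 z) ∈
        J.map (proj ℓ N).toLinearMap := by
    induction z using MonoidAlgebra.induction_linear with
    | zero => simp
    | add a b ha hb =>
      rw [map_add, MonoidAlgebra.single_add, add_sub_add_comm]
      exact Submodule.add_mem _ ha hb
    | single q a =>
      induction q using QuotientGroup.induction_on with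
      | H g =>
        refine ⟨a • (of ℓ g - 1), J.smul_mem a (hJ g), ?_⟩
        change proj ℓ N (a • (of ℓ g - 1)) = _
        rw [map_smul, map_sub, proj_of, map_one, smul_sub, MonoidAlgebra.smul_single,
          MonoidAlgebra.one_def, MonoidAlgebra.smul_single]
        simp
  have h0 : MonoidAlgebra.lift ℤ_[ℓ] ℤ_[ℓ] (G ⧸ N.toSubgroup) 1 (proj ℓ N x) = 0 :=
    (lift_one_proj N x).trans hx
  simpa [h0] using key (proj ℓ N x)

theorem augIdeal_pow_mul_mem (n : ℕ) {x : CompletedGroupRing ℓ G} (hx : x ∈ augIdeal ℓ G ^ (n + 1))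
    (y : CompletedGroupRing ℓ G) : x * y ∈ augIdeal ℓ G ^ (n + 1) := by
  have h1 : augIdeal ℓ G * ⊤ ≤ augIdeal ℓ G := by
    rw [Submodule.mul_le]
    intro a ha b _
    have ha0 : augmentation ℓ G a = 0 := ha
    change augmentation ℓ G (a * b) = 0
    rw [map_mul, ha0, zero_mul]
  have h2 : augIdeal ℓ G ^ (n + 1) * ⊤ ≤ augIdeal ℓ G ^ (n + 1) := by
    rw [pow_succ, mul_assoc]
    exact mul_le_mul_right h1 _
  exact h2 (Submodule.mul_mem_mul hx trivial)

variable [IsTopologicalGroup G] [CompactSpace G]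

theorem continuous_generatorMap (S : Finset G) : Continuous (generatorMap ℓ S) :=
  continuous_finsetSum _ fun s _ =>
    (CompletedGroupRing.continuous_mul_right _).comp (continuous_apply s)

/-- A closed submodule that contains all `[g] - 1` contains the augmentation ideal. -/
theorem augIdeal_le_of_isClosed {J : Submodule ℤ_[ℓ] (CompletedGroupRing ℓ G)}
    (hc : IsClosed (J : Set (CompletedGroupRing ℓ G))) (hJ : ∀ g, of ℓ g - 1 ∈ J) :
    augIdeal ℓ G ≤ J := by
  intro x hx
  -- The elements of `J` that agree with `x` at level `N` form a directed family of nonempty compact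
  -- sets. A common point has all projections equal to those of `x`.
  let T (N : OpenNormalSubgroup G) : Set (CompletedGroupRing ℓ G) :=
    {y | y ∈ J ∧ proj ℓ N y = proj ℓ N x}
  have hT (N) : IsClosed (T N) := by
    have : T N = (J : Set (CompletedGroupRing ℓ G)) ∩
        ⋂ q, {y | (proj ℓ N y).coeff q = (proj ℓ N x).coeff q} := by
      ext y
      simp only [T, Set.mem_inter_iff, Set.mem_iInter]
      exact and_congr Iff.rfl ⟨fun h q => congrArg (fun z => MonoidAlgebra.coeff z q) h,
        fun h => MonoidAlgebra.coeff_injective (Finsupp.ext h)⟩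
    rw [this]
    exact hc.inter (isClosed_iInter fun q =>
      isClosed_eq (continuous_coeff_proj N q) continuous_const)
  have hmono {N M : OpenNormalSubgroup G} (h : N ≤ M) : T N ⊆ T M := fun y hy => by
    have h' : ∀ g ∈ N.toSubgroup, MonoidHom.id G g ∈ M.toSubgroup := fun _ hg => h hg
    exact ⟨hy.1, by rw [← transition_proj y h', hy.2, transition_proj]⟩
  have : Nonempty (OpenNormalSubgroup G) := ⟨wholeGroup G⟩
  obtain ⟨y, hy⟩ := IsCompact.nonempty_iInter_of_directed_nonempty_isCompact_isClosed T
    (fun N M => ⟨N ⊓ M, hmono inf_le_left, hmono inf_le_right⟩)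
    (fun N => by
      obtain ⟨y, hy, h⟩ := proj_mem_of_augIdeal hJ hx N
      exact ⟨y, hy, h⟩) (fun N => (hT N).isCompact) hT
  have hyx : y = x := CompletedGroupRing.ext fun N => (Set.mem_iInter.1 hy N).2
  exact hyx ▸ (Set.mem_iInter.1 hy (wholeGroup G)).1

/-- The left ideal generated by the `[s] - 1` is closed, being the image of a compact space. The `g`
with `[g] - 1` in it form a closed subgroup containing `S`, which is therefore all of `G`. -/
theorem augIdeal_le_range_generatorMap {S : Finset G}
    (hS : (Subgroup.closure (S : Set G)).topologicalClosure = ⊤) :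
    augIdeal ℓ G ≤ LinearMap.range (generatorMap ℓ S) := by
  have hc : IsClosed (LinearMap.range (generatorMap ℓ S) : Set (CompletedGroupRing ℓ G)) :=
    (isCompact_range (continuous_generatorMap S)).isClosed
  refine augIdeal_le_of_isClosed hc ?_
  let H : Subgroup G :=
    { carrier := {g | of ℓ g - 1 ∈ LinearMap.range (generatorMap ℓ S)}
      one_mem' := by
        change of ℓ 1 - 1 ∈ LinearMap.range (generatorMap ℓ S)
        rw [map_one, sub_self]
        exact Submodule.zero_mem _
      mul_mem' := fun {g h} hg hh => by
        change of ℓ (g * h) - 1 ∈ LinearMap.range (generatorMap ℓ S)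
        have e : of ℓ (g * h) - 1 = of ℓ g * (of ℓ h - 1) + (of ℓ g - 1) := by
          rw [map_mul]; noncomm_ring
        rw [e]
        exact Submodule.add_mem _ (mul_mem_range_generatorMap _ hh) hg
      inv_mem' := fun {g} hg => by
        change of ℓ g⁻¹ - 1 ∈ LinearMap.range (generatorMap ℓ S)
        have e : of ℓ g⁻¹ - 1 = (-of ℓ g⁻¹) * (of ℓ g - 1) := by
          have : of ℓ g⁻¹ * of ℓ g = 1 := by rw [← map_mul, inv_mul_cancel, map_one]
          rw [neg_mul, mul_sub, this, mul_one, neg_sub]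
        rw [e]
        exact mul_mem_range_generatorMap _ hg }
  have hH : IsClosed (H : Set G) := hc.preimage (continuous_of.sub continuous_const)
  have hle : (Subgroup.closure (S : Set G)).topologicalClosure ≤ H := by
    refine Subgroup.topologicalClosure_minimal _ ((Subgroup.closure_le _).2 fun s hs => ?_) hH
    classical
    refine ⟨Pi.single ⟨s, hs⟩ 1, ?_⟩
    rw [generatorMap_apply, Finset.sum_eq_single ⟨s, hs⟩]
    · rw [Pi.single_eq_same, one_mul]
    · intro t _ ht
      rw [Pi.single_eq_of_ne ht, zero_mul]
    · exact fun h => absurd (Finset.mem_univ _) h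
  intro g
  exact hle (hS ▸ Subgroup.mem_top g)

/-- An element of `I` is `∑ y_s ([s] - 1)`, and `I^(n+1)` absorbs the coefficients `y_s` on its
right. This presents an algebraic span as the continuous image of a finite power of `I^(n+1)`, so
closedness passes by induction from one power to the next. -/
theorem augIdeal_pow_eq_map {S : Finset G}
    (hS : (Subgroup.closure (S : Set G)).topologicalClosure = ⊤) (n : ℕ) :
    augIdeal ℓ G ^ (n + 2) =
      (Submodule.pi Set.univ fun _ => augIdeal ℓ G ^ (n + 1)).map (generatorMap ℓ S) := by
  refine le_antisymm ?_ ?_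
  · rw [pow_succ _ (n + 1), Submodule.mul_le]
    intro a ha b hb
    obtain ⟨y, rfl⟩ := augIdeal_le_range_generatorMap hS hb
    refine ⟨fun s => a * y s, fun s _ => augIdeal_pow_mul_mem n ha _, ?_⟩
    simp [generatorMap_apply, Finset.mul_sum, mul_assoc]
  · rintro _ ⟨y, hy, rfl⟩
    rw [generatorMap_apply, pow_succ _ (n + 1)]
    exact Submodule.sum_mem _ fun s _ => Submodule.mul_mem_mul (hy s trivial) (of_sub_one_mem s.1)

variable [TopologicallyFG G]

theorem isClosed_augIdeal_pow (n : ℕ) :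
    IsClosed ((augIdeal ℓ G ^ (n + 1) : Submodule ℤ_[ℓ] (CompletedGroupRing ℓ G)) :
      Set (CompletedGroupRing ℓ G)) := by
  obtain ⟨S, hS⟩ := TopologicallyFG.out (G := G)
  induction n with
  | zero =>
    rw [zero_add, pow_one]
    exact isClosed_singleton.preimage (continuous_augmentation (ℓ := ℓ) (G := G))
  | succ n ih =>
    rw [augIdeal_pow_eq_map hS, Submodule.map_coe]
    refine (IsCompact.image ?_ (continuous_generatorMap S)).isClosed
    rw [Submodule.coe_pi]
    exact isCompact_univ_pi fun _ => ih.isCompact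

end Generators

/-! ### Finiteness and topology of the subquotients -/

section Subquotients

variable {ℓ : ℕ} [Fact ℓ.Prime] {G : Type u} [Group G] [TopologicalSpace G]

instance (m n : ℕ) : ContinuousSMul ℤ_[ℓ] (AugQuot ℓ G m n) :=
  inferInstanceAs (ContinuousSMul ℤ_[ℓ] (↥(augIdeal ℓ G ^ m) ⧸
    (augIdeal ℓ G ^ n).submoduleOf (augIdeal ℓ G ^ m)))

theorem AugQuot.continuous_mk (m n : ℕ) : Continuous (AugQuot.mk ℓ G m n) := continuous_quot_mk

variable (ℓ) in
theorem of_sub_one_mem_pow_one (g : G) : of ℓ g - 1 ∈ augIdeal ℓ G ^ 1 := by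
  rw [pow_one]
  exact of_sub_one_mem g

variable (ℓ) in
/-- The class of `[g] - 1` in `V = I / I²`. -/
noncomputable def groupToV (g : G) : V ℓ G :=
  AugQuot.mk ℓ G 1 2 ⟨of ℓ g - 1, of_sub_one_mem_pow_one ℓ g⟩

theorem mulTensor_surjective : Function.Surjective (mulTensor ℓ G) := by
  rw [← LinearMap.range_eq_top, eq_top_iff]
  rintro u -
  obtain ⟨⟨x, hx⟩, rfl⟩ := AugQuot.mk_surjective u
  have key : ∀ y ∈ augIdeal ℓ G ^ 1 * augIdeal ℓ G ^ 1, ∃ h : y ∈ augIdeal ℓ G ^ 2,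
      AugQuot.mk ℓ G 2 3 ⟨y, h⟩ ∈ LinearMap.range (mulTensor ℓ G) := by
    intro y hy
    induction hy using Submodule.mul_induction_on' with
    | mem_mul_mem a ha b hb =>
      exact ⟨mul_mem_pow ha hb, AugQuot.mk ℓ G 1 2 ⟨a, ha⟩ ⊗ₜ AugQuot.mk ℓ G 1 2 ⟨b, hb⟩,
        by rw [mulTensor, TensorProduct.lift.tmul, mulV_mk]⟩
    | add a _ b _ ha hb =>
      obtain ⟨ha, ha'⟩ := ha
      obtain ⟨hb, hb'⟩ := hb
      refine ⟨add_mem ha hb, ?_⟩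
      exact (LinearMap.range (mulTensor ℓ G)).add_mem ha' hb'
  exact (key x (by rwa [← pow_add])).2

variable [IsTopologicalGroup G] [CompactSpace G]

/-- Modulo `I²`, each coefficient in `∑ y_s ([s] - 1)` may be replaced by its augmentation. -/
theorem span_groupToV {S : Finset G}
    (hS : (Subgroup.closure (S : Set G)).topologicalClosure = ⊤) :
    Submodule.span ℤ_[ℓ] (Set.range fun s : S => groupToV ℓ s.1) = ⊤ := by
  rw [eq_top_iff]
  rintro v -
  obtain ⟨⟨x, hx⟩, rfl⟩ := AugQuot.mk_surjective v
  obtain ⟨y, rfl⟩ := augIdeal_le_range_generatorMap hS (by rwa [pow_one] at hx)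
  have h : AugQuot.mk ℓ G 1 2 ⟨generatorMap ℓ S y, hx⟩ =
      ∑ s, augmentation ℓ G (y s) • groupToV ℓ s.1 := by
    simp only [groupToV]
    simp only [← map_smul]
    rw [← map_sum, ← sub_eq_zero, ← map_sub]
    refine AugQuot.mk_eq_zero.2 ?_
    simp only [AddSubgroupClass.coe_sub, AddSubmonoidClass.coe_finsetSum, SetLike.val_smul,
      generatorMap_apply]
    rw [← Finset.sum_sub_distrib]
    refine Submodule.sum_mem _ fun s _ => ?_
    rw [Algebra.smul_def, ← sub_mul, pow_two]
    refine Submodule.mul_mem_mul ?_ (of_sub_one_mem s.1)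
    change augmentation ℓ G _ = 0
    rw [map_sub, AlgHom.commutes]
    exact sub_self _
  rw [h]
  exact Submodule.sum_mem _ fun s _ => Submodule.smul_mem _ _ (Submodule.subset_span ⟨s, rfl⟩)

variable [TopologicallyFG G]

instance (m n : ℕ) : CompactSpace (AugQuot ℓ G (m + 1) n) := by
  have : CompactSpace ↥(augIdeal ℓ G ^ (m + 1)) :=
    isCompact_iff_compactSpace.1 (isClosed_augIdeal_pow m).isCompact
  exact ⟨(Set.range_eq_univ.2 (AugQuot.mk_surjective (ℓ := ℓ) (G := G))) ▸
    isCompact_range (AugQuot.continuous_mk (m + 1) n)⟩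

instance (m n : ℕ) : T2Space (AugQuot ℓ G m (n + 1)) := by
  have : IsClosed (((augIdeal ℓ G ^ (n + 1)).submoduleOf (augIdeal ℓ G ^ m) :
      Submodule ℤ_[ℓ] ↥(augIdeal ℓ G ^ m)) : Set ↥(augIdeal ℓ G ^ m)) :=
    (isClosed_augIdeal_pow n).preimage continuous_subtype_val
  exact inferInstanceAs (T2Space (↥(augIdeal ℓ G ^ m) ⧸
    (augIdeal ℓ G ^ (n + 1)).submoduleOf (augIdeal ℓ G ^ m)))

instance : T2Space (V ℓ G) := inferInstanceAs (T2Space (AugQuot ℓ G 1 (1 + 1)))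
instance : T2Space (U ℓ G) := inferInstanceAs (T2Space (AugQuot ℓ G 2 (2 + 1)))
instance : T2Space (E ℓ G) := inferInstanceAs (T2Space (AugQuot ℓ G 1 (2 + 1)))
instance : CompactSpace (U ℓ G) := inferInstanceAs (CompactSpace (AugQuot ℓ G (1 + 1) 3))

theorem span_range_groupToV : Submodule.span ℤ_[ℓ] (Set.range (groupToV ℓ : G → V ℓ G)) = ⊤ := by
  obtain ⟨S, hS⟩ := TopologicallyFG.out (G := G)
  rw [eq_top_iff, ← span_groupToV hS]
  exact Submodule.span_mono (by rintro _ ⟨s, rfl⟩; exact ⟨s.1, rfl⟩)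

instance : Module.Finite ℤ_[ℓ] (V ℓ G) := by
  obtain ⟨S, hS⟩ := TopologicallyFG.out (G := G)
  exact ⟨span_groupToV (ℓ := ℓ) hS ▸ Submodule.fg_span (Set.finite_range _)⟩

instance : Module.Finite ℤ_[ℓ] (U ℓ G) :=
  Module.Finite.of_surjective (mulTensor ℓ G) mulTensor_surjective

theorem isClosed_W : IsClosed (W ℓ G : Set (U ℓ G)) :=
  isClosed_of_fg (IsNoetherian.noetherian _)

end Subquotients

/-! ### The abelianization and `V` -/

section GroupElements

variable {ℓ : ℕ} [Fact ℓ.Prime] {G : Type u} [Group G] [TopologicalSpace G]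

theorem groupToV_mul (g h : G) : groupToV ℓ (g * h) = groupToV ℓ g + groupToV ℓ h := by
  simp only [groupToV]
  rw [← map_add, ← sub_eq_zero, ← map_sub]
  refine AugQuot.mk_eq_zero.2 ?_
  change of ℓ (g * h) - 1 - ((of ℓ g - 1) + (of ℓ h - 1)) ∈ augIdeal ℓ G ^ 2
  have e : of ℓ (g * h) - 1 - ((of ℓ g - 1) + (of ℓ h - 1)) = (of ℓ g - 1) * (of ℓ h - 1) := by
    rw [map_mul]; noncomm_ring
  rw [e, pow_two]
  exact Submodule.mul_mem_mul (of_sub_one_mem g) (of_sub_one_mem h)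

theorem groupToV_eq_zero {g : G} : groupToV ℓ g = 0 ↔ of ℓ g - 1 ∈ augIdeal ℓ G ^ 2 := by
  rw [groupToV, AugQuot.mk_eq_zero]

theorem augRep_mk_of_sub_one (n : ℕ) (σ : ContAut G) (g : G) :
    augRep ℓ G 1 n σ (AugQuot.mk ℓ G 1 n ⟨of ℓ g - 1, of_sub_one_mem_pow_one ℓ g⟩) =
      AugQuot.mk ℓ G 1 n ⟨of ℓ (σ g) - 1, of_sub_one_mem_pow_one ℓ (σ g)⟩ := by
  have h : CompletedGroupRing.map σ (of ℓ g - 1) = of ℓ (σ g) - 1 := by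
    rw [map_sub, map_one, map_of]
  rw [augRep_mk]
  exact congrArg (AugQuot.mk ℓ G 1 n) (Subtype.ext h)

theorem augRep_groupToV (σ : ContAut G) (g : G) :
    augRep ℓ G 1 2 σ (groupToV ℓ g) = groupToV ℓ (σ g) :=
  augRep_mk_of_sub_one 2 σ g

variable (ℓ G) in
/-- The homomorphism `G → V`, `g ↦ [g] - 1`. -/
noncomputable def groupToVHom : G →* Multiplicative (V ℓ G) :=
  MonoidHom.mk' (fun g => Multiplicative.ofAdd (groupToV ℓ g))
    fun g h => congrArg Multiplicative.ofAdd (groupToV_mul g h)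

theorem groupToV_one : groupToV ℓ (1 : G) = 0 := map_one (groupToVHom ℓ G)

theorem groupToV_inv (g : G) : groupToV ℓ g⁻¹ = -groupToV ℓ g := map_inv (groupToVHom ℓ G) g

theorem groupToV_pow (g : G) (n : ℕ) : groupToV ℓ (g ^ n) = n • groupToV ℓ g :=
  map_pow (groupToVHom ℓ G) g n

theorem groupToV_zpow (g : G) (n : ℤ) : groupToV ℓ (g ^ n) = n • groupToV ℓ g :=
  map_zpow (groupToVHom ℓ G) g n

variable [IsTopologicalGroup G]

theorem continuous_groupToV : Continuous (groupToV ℓ : G → V ℓ G) :=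
  (AugQuot.continuous_mk 1 2).comp ((continuous_of.sub continuous_const).subtype_mk _)

variable [CompactSpace G] [TopologicallyFG G]

theorem groupToV_eq_zero_of_mem {c : G} (hc : c ∈ (commutator G).topologicalClosure) :
    groupToV ℓ c = 0 := by
  have hcl : IsClosed ((groupToVHom ℓ G).ker : Set G) :=
    isClosed_singleton.preimage continuous_groupToV
  exact Subgroup.topologicalClosure_minimal _
    (Abelianization.commutator_subset_ker (groupToVHom ℓ G)) hcl hc

theorem groupToV_congr {g h : G}
    (H : (g : TopologicalAbelianization G) = (h : TopologicalAbelianization G)) :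
    groupToV ℓ g = groupToV ℓ h := by
  have := groupToV_eq_zero_of_mem (ℓ := ℓ) (QuotientGroup.eq.1 H)
  rw [groupToV_mul, groupToV_inv] at this
  exact (neg_add_eq_zero.1 this)

/-- The image is a compact, hence closed, subgroup. As `ℤ` is dense in `ℤ_ℓ`, it is a
`ℤ_ℓ`-submodule, and it contains generators of `V`. -/
theorem groupToV_surjective : Function.Surjective (groupToV ℓ : G → V ℓ G) := by
  let H : AddSubgroup (V ℓ G) :=
    { carrier := Set.range (groupToV ℓ)
      zero_mem' := ⟨1, groupToV_one⟩
      add_mem' := by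
        rintro _ _ ⟨g, rfl⟩ ⟨h, rfl⟩
        exact ⟨g * h, groupToV_mul g h⟩
      neg_mem' := by
        rintro _ ⟨g, rfl⟩
        exact ⟨g⁻¹, groupToV_inv g⟩ }
  have hcl : IsClosed (H : Set (V ℓ G)) := (isCompact_range continuous_groupToV).isClosed
  let P : Submodule ℤ_[ℓ] (V ℓ G) :=
    { H with
      smul_mem' := by
        rintro a _ ⟨g, rfl⟩
        have hS : IsClosed {a : ℤ_[ℓ] | a • groupToV ℓ g ∈ H} :=
          hcl.preimage (f := fun a : ℤ_[ℓ] => a • groupToV ℓ g) (by fun_prop)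
        refine PadicInt.denseRange_intCast.induction_on a hS fun n => ?_
        exact ⟨g ^ n, by rw [groupToV_zpow, Int.cast_smul_eq_zsmul]⟩ }
  intro v
  have hP : Submodule.span ℤ_[ℓ] (Set.range (groupToV ℓ)) ≤ P :=
    Submodule.span_le.2 fun _ h => h
  exact hP (span_range_groupToV (ℓ := ℓ) (G := G) ▸ Submodule.mem_top)

end GroupElements

/-! ### Commutators and `W` -/

section Commutators

variable (ℓ : ℕ) [Fact ℓ.Prime] (G : Type u) [Group G] [TopologicalSpace G]

/-- The preimage of `W` in `I²`, as a submodule of `ℤ_ℓ[[G]]`. -/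
noncomputable def preimageW : Submodule ℤ_[ℓ] (CompletedGroupRing ℓ G) :=
  ((W ℓ G).comap (AugQuot.mk ℓ G 2 3)).map (augIdeal ℓ G ^ 2).subtype

variable {ℓ G}

theorem mem_preimageW {x : CompletedGroupRing ℓ G} (hx : x ∈ augIdeal ℓ G ^ 2) :
    x ∈ preimageW ℓ G ↔ AugQuot.mk ℓ G 2 3 ⟨x, hx⟩ ∈ W ℓ G := by
  constructor
  · rintro ⟨y, hy, rfl⟩
    exact hy
  · intro h
    exact ⟨⟨x, hx⟩, h, rfl⟩

theorem preimageW_le : preimageW ℓ G ≤ augIdeal ℓ G ^ 2 := Submodule.map_subtype_le _ _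

theorem augIdeal_pow_three_le_preimageW : augIdeal ℓ G ^ 3 ≤ preimageW ℓ G := fun x hx => by
  rw [mem_preimageW (augIdeal_pow_succ_le 1 hx),
    AugQuot.mk_eq_zero.2 hx]
  exact Submodule.zero_mem _

theorem mul_sub_mul_mem_preimageW {x y : CompletedGroupRing ℓ G} (hx : x ∈ augIdeal ℓ G)
    (hy : y ∈ augIdeal ℓ G) : x * y - y * x ∈ preimageW ℓ G := by
  have hx' : x ∈ augIdeal ℓ G ^ 1 := by rwa [pow_one]
  have hy' : y ∈ augIdeal ℓ G ^ 1 := by rwa [pow_one]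
  rw [mem_preimageW (sub_mem (mul_mem_pow hx' hy') (mul_mem_pow hy' hx'))]
  exact commutatorMap_mem ℓ G (AugQuot.mk ℓ G 1 2 ⟨x, hx'⟩) (AugQuot.mk ℓ G 1 2 ⟨y, hy'⟩)

variable [IsTopologicalGroup G] [CompactSpace G] [TopologicallyFG G]

theorem isClosed_preimageW : IsClosed (preimageW ℓ G : Set (CompletedGroupRing ℓ G)) := by
  rw [preimageW, Submodule.map_coe]
  exact (isClosed_augIdeal_pow 1).isClosedEmbedding_subtypeVal.isClosedMap _
    (isClosed_W.preimage (AugQuot.continuous_mk 2 3))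

/-- The `g` with `[g] - 1` in the preimage of `W` form a subgroup, since the error terms in products
and inverses lie in `I² · I = I³`. It is closed, so it suffices to treat commutators. -/
theorem of_sub_one_mem_preimageW {c : G} (hc : c ∈ (commutator G).topologicalClosure) :
    of ℓ c - 1 ∈ preimageW ℓ G := by
  have hmul {g h : G} (hg : of ℓ g - 1 ∈ preimageW ℓ G) (hh : of ℓ h - 1 ∈ preimageW ℓ G) :
      of ℓ (g * h) - 1 ∈ preimageW ℓ G := by
    have e : of ℓ (g * h) - 1 =
        (of ℓ g - 1) * (of ℓ h - 1) + ((of ℓ g - 1) + (of ℓ h - 1)) := by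
      rw [map_mul]; noncomm_ring
    rw [e]
    refine add_mem (augIdeal_pow_three_le_preimageW ?_) (add_mem hg hh)
    exact mul_mem_pow (m := 2) (n := 1) (preimageW_le hg) (of_sub_one_mem_pow_one ℓ h)
  let H : Subgroup G :=
    { carrier := {g | of ℓ g - 1 ∈ preimageW ℓ G}
      one_mem' := by
        change of ℓ 1 - 1 ∈ preimageW ℓ G
        rw [map_one, sub_self]
        exact Submodule.zero_mem _
      mul_mem' := hmul
      inv_mem' := fun {g} hg => by
        change of ℓ g⁻¹ - 1 ∈ preimageW ℓ G
        have hg' : of ℓ g - 1 ∈ preimageW ℓ G := hg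
        have h1 : of ℓ g * of ℓ g⁻¹ = 1 := by rw [← map_mul, mul_inv_cancel, map_one]
        have e : of ℓ g⁻¹ - 1 = -((of ℓ g - 1) + (of ℓ g - 1) * (of ℓ g⁻¹ - 1)) := by
          rw [mul_sub, sub_mul, h1]; noncomm_ring
        rw [e]
        refine neg_mem (add_mem hg' (augIdeal_pow_three_le_preimageW ?_))
        exact mul_mem_pow (m := 2) (n := 1) (preimageW_le hg') (of_sub_one_mem_pow_one ℓ _) }
  have hH : IsClosed (H : Set G) :=
    isClosed_preimageW.preimage (continuous_of.sub continuous_const)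
  refine (Subgroup.topologicalClosure_minimal (commutator G) (t := H) ?_ hH) hc
  rw [commutator_eq_closure, Subgroup.closure_le]
  rintro _ ⟨a, b, rfl⟩
  change of ℓ ⁅a, b⁆ - 1 ∈ preimageW ℓ G
  have hw := mul_sub_mul_mem_preimageW (of_sub_one_mem (ℓ := ℓ) a) (of_sub_one_mem b)
  have h1 : of ℓ (b * a) * of ℓ (a⁻¹ * b⁻¹) = 1 := by
    rw [← map_mul]
    convert map_one (of ℓ (G := G)) using 2
    group
  -- From `[⁅a, b⁆] - 1 = ([ab] - [ba]) [(ba)⁻¹]`, where `[ab] - [ba]` is the ring commutator of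
  -- `[a] - 1` and `[b] - 1`; replacing `[(ba)⁻¹]` by `1` costs an element of `I³`.
  have e : of ℓ ⁅a, b⁆ - 1 =
      ((of ℓ a - 1) * (of ℓ b - 1) - (of ℓ b - 1) * (of ℓ a - 1)) +
      ((of ℓ a - 1) * (of ℓ b - 1) - (of ℓ b - 1) * (of ℓ a - 1)) * (of ℓ (a⁻¹ * b⁻¹) - 1) := by
    have h2 : (of ℓ a - 1) * (of ℓ b - 1) - (of ℓ b - 1) * (of ℓ a - 1) =
        of ℓ (a * b) - of ℓ (b * a) := by
      rw [map_mul, map_mul]; noncomm_ring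
    rw [h2, mul_sub, mul_one, add_sub_cancel, sub_mul, h1, ← map_mul, commutatorElement_def,
      mul_assoc (a * b)]
  rw [e]
  refine add_mem hw (augIdeal_pow_three_le_preimageW ?_)
  exact mul_mem_pow (m := 2) (n := 1) (preimageW_le hw) (of_sub_one_mem_pow_one ℓ _)

/-- Elements of `G` that agree in the abelianization agree in `ℤ_ℓ[[G]]` modulo the preimage
of `W`. -/
theorem of_sub_of_mem_preimageW {g h : G}
    (H : (g : TopologicalAbelianization G) = (h : TopologicalAbelianization G)) :
    of ℓ g - of ℓ h ∈ preimageW ℓ G := by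
  have hc : h⁻¹ * g ∈ (commutator G).topologicalClosure := QuotientGroup.eq.1 H.symm
  have hw := of_sub_one_mem_preimageW (ℓ := ℓ) hc
  have e : of ℓ g - of ℓ h = (of ℓ (h⁻¹ * g) - 1) + (of ℓ h - 1) * (of ℓ (h⁻¹ * g) - 1) := by
    have h1 : of ℓ h * of ℓ (h⁻¹ * g) = of ℓ g := by rw [← map_mul, mul_inv_cancel_left]
    rw [mul_sub, sub_mul, h1]; noncomm_ring
  rw [e]
  refine add_mem hw (augIdeal_pow_three_le_preimageW ?_)
  exact mul_mem_pow (m := 1) (n := 2) (of_sub_one_mem_pow_one ℓ h) (preimageW_le hw)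

end Commutators

/-! ### Linear functionals on group algebras -/

section Functionals

variable {R Q M : Type*} [CommRing R]

/-- The linear extension of a function on a group to the group algebra. -/
noncomputable def linearExtension [AddCommGroup M] [Module R M] (F : Q → M) :
    MonoidAlgebra R Q →ₗ[R] M :=
  Finsupp.linearCombination R F ∘ₗ (MonoidAlgebra.coeffLinearEquiv R).toLinearMap

theorem linearExtension_single [AddCommGroup M] [Module R M] (F : Q → M) (q : Q) (a : R) :
    linearExtension F (MonoidAlgebra.single q a) = a • F q :=
  Finsupp.linearCombination_single R a q

variable [Group Q]

/-- The extension of an additive function is a derivation relative to the augmentation; it therefore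
kills products of two elements of augmentation zero. -/
theorem linearExtension_mul [AddCommGroup M] [Module R M] {F : Q → M}
    (hF : ∀ p q, F (p * q) = F p + F q) (x y : MonoidAlgebra R Q) :
    linearExtension F (x * y) = MonoidAlgebra.lift R R Q 1 y • linearExtension F x +
      MonoidAlgebra.lift R R Q 1 x • linearExtension F y := by
  induction x using MonoidAlgebra.induction_linear with
  | zero => simp
  | add a b ha hb => simp only [add_mul, map_add, ha, hb, smul_add, add_smul]; abel
  | single p a =>
    induction y using MonoidAlgebra.induction_linear with
    | zero => simp
    | add c d hc hd => simp only [mul_add, map_add, hc, hd, smul_add, add_smul]; abel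
    | single q b =>
      simp only [MonoidAlgebra.single_mul_single, linearExtension_single, hF,
        MonoidAlgebra.lift_single, MonoidHom.one_apply, smul_add, smul_smul, smul_eq_mul, mul_one]
      rw [mul_comm b a]

/-- The functional extending the product of two homomorphisms to an algebra is, up to terms that
vanish on the augmentation ideal, the symmetrized product of their extensions. -/
theorem linearExtension_mul_mul [CommRing M] [Algebra R M] {F F' : Q → M}
    (hF : ∀ p q, F (p * q) = F p + F q) (hF' : ∀ p q, F' (p * q) = F' p + F' q)
    (x y : MonoidAlgebra R Q) :
    linearExtension (fun q => F q * F' q) (x * y) =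
      MonoidAlgebra.lift R R Q 1 y • linearExtension (fun q => F q * F' q) x +
      MonoidAlgebra.lift R R Q 1 x • linearExtension (fun q => F q * F' q) y +
      (linearExtension F x * linearExtension F' y +
        linearExtension F y * linearExtension F' x) := by
  induction x using MonoidAlgebra.induction_linear with
  | zero => simp
  | add a b ha hb =>
    simp only [add_mul, map_add, ha, hb, smul_add, add_smul, mul_add]; abel
  | single p a =>
    induction y using MonoidAlgebra.induction_linear with
    | zero => simp
    | add c d hc hd => simp only [mul_add, map_add, hc, hd, smul_add, add_smul, add_mul]; abel
    | single q b =>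
      simp only [MonoidAlgebra.single_mul_single, linearExtension_single, hF, hF',
        MonoidAlgebra.lift_single, MonoidHom.one_apply, smul_eq_mul, mul_one, Algebra.smul_def,
        map_mul]
      ring

variable {ℓ : ℕ} [Fact ℓ.Prime] {G : Type u} [Group G] [TopologicalSpace G]

theorem linearExtension_proj_eq_zero [AddCommGroup M] [Module ℤ_[ℓ] M] {N : OpenNormalSubgroup G}
    {F : G ⧸ N.toSubgroup → M} (hF : ∀ p q, F (p * q) = F p + F q) {x : CompletedGroupRing ℓ G}
    (hx : x ∈ augIdeal ℓ G ^ 2) : linearExtension F (proj ℓ N x) = 0 := by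
  rw [pow_two] at hx
  induction hx using Submodule.mul_induction_on' with
  | mem_mul_mem a ha b hb =>
    have ha0 : augmentation ℓ G a = 0 := ha
    have hb0 : augmentation ℓ G b = 0 := hb
    rw [map_mul, linearExtension_mul hF, lift_one_proj, lift_one_proj, ha0, hb0]
    simp
  | add a _ b _ ha hb => rw [map_add, map_add, ha, hb, add_zero]

end Functionals

/-! ### `V` is free -/

section Freeness

variable {ℓ : ℕ} [Fact ℓ.Prime] {G : Type u} [Group G] [TopologicalSpace G]
  [IsTopologicalGroup G] [CompactSpace G]

/-- The finite abelian `ℓ`-group `G ⧸ N` is a `ℤ_ℓ`-module through `ℤ/ℓ^k`. The linear extension of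
its identity map kills `I²`, and it sends `[h] - 1` to the class of `h`. -/
theorem mem_of_groupToV_eq_zero {N : OpenNormalSubgroup G} (hN : commutator G ≤ N.toSubgroup)
    (hp : IsPGroup ℓ (G ⧸ N.toSubgroup)) {h : G} (hh : groupToV ℓ h = 0) : h ∈ N.toSubgroup := by
  let _ : CommGroup (G ⧸ N.toSubgroup) :=
    { (inferInstance : Group (G ⧸ N.toSubgroup)) with
      mul_comm := fun p q => by
        induction p using QuotientGroup.induction_on with
        | H a =>
          induction q using QuotientGroup.induction_on with
          | H b =>
            refine QuotientGroup.eq.2 (hN ?_)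
            have e : (a * b)⁻¹ * (b * a) = ⁅b⁻¹, a⁻¹⁆ := by
              rw [commutatorElement_def]; group
            rw [e]
            exact Subgroup.commutator_mem_commutator (Subgroup.mem_top _) (Subgroup.mem_top _) }
  obtain ⟨k, hk⟩ := IsPGroup.iff_card.1 hp
  let _ : Module (ZMod (ℓ ^ k)) (Additive (G ⧸ N.toSubgroup)) :=
    AddCommGroup.zmodModule fun x => by
      rw [← hk]
      exact pow_card_eq_one' (G := G ⧸ N.toSubgroup) (x := x.toMul)
  let _ : Module ℤ_[ℓ] (Additive (G ⧸ N.toSubgroup)) := Module.compHom _ (PadicInt.toZModPow k)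
  let F : G ⧸ N.toSubgroup → Additive (G ⧸ N.toSubgroup) := Additive.ofMul
  have h0 := linearExtension_proj_eq_zero (F := F) (fun _ _ => rfl) (groupToV_eq_zero.1 hh)
  rw [map_sub, map_sub, map_one, proj_of, MonoidAlgebra.one_def, linearExtension_single,
    linearExtension_single, one_smul, one_smul] at h0
  have h1 : (h : G ⧸ N.toSubgroup) = 1 := Additive.ofMul.injective (sub_eq_zero.1 h0)
  exact (QuotientGroup.eq_one_iff h).1 h1

/-- If `h` were outside the closure, some coset `hN` would miss it. But `h` lies in the open
subgroup generated by `N` and the commutators, so `hN` contains an element of the commutator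
subgroup. -/
theorem mem_closure_commutator_of_groupToV_eq_zero [TotallyDisconnectedSpace G]
    (hproEll : ∀ N : OpenNormalSubgroup G, IsPGroup ℓ (G ⧸ N.toSubgroup)) {h : G}
    (hh : groupToV ℓ h = 0) : h ∈ (commutator G).topologicalClosure := by
  by_contra hn
  have hopen : IsOpen {g : G | h * g ∈ ((commutator G).topologicalClosure : Set G)ᶜ} :=
    (Subgroup.isClosed_topologicalClosure _).isOpen_compl.preimage (continuous_const_mul h)
  obtain ⟨N, hN⟩ := ProfiniteGrp.exist_openNormalSubgroup_sub_open_nhds_of_one hopen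
    (by rwa [Set.mem_ofPred_eq, mul_one])
  let M : OpenNormalSubgroup G :=
    { toOpenSubgroup := ⟨commutator G ⊔ N.toSubgroup,
        Subgroup.isOpen_mono le_sup_right N.isOpen'⟩
      isNormal' := (inferInstance : (commutator G ⊔ N.toSubgroup).Normal) }
  have hM : h ∈ commutator G ⊔ N.toSubgroup :=
    mem_of_groupToV_eq_zero (N := M) le_sup_left (hproEll M) hh
  obtain ⟨c, hc, n, hn', rfl⟩ := Subgroup.mem_sup_of_normal_right.1 hM
  refine hN (N.toSubgroup.inv_mem hn') ?_
  rw [mul_inv_cancel_right]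
  exact Subgroup.le_topologicalClosure _ hc

/-- A nonzero scalar is a unit times a power of `ℓ`, so torsion in `V` comes from some `g` with `g ^
ℓ^k` in the closed commutator subgroup. -/
theorem isTorsionFree_V [TotallyDisconnectedSpace G] [TopologicallyFG G]
    (hproEll : ∀ N : OpenNormalSubgroup G, IsPGroup ℓ (G ⧸ N.toSubgroup))
    (htf : IsMulTorsionFree (TopologicalAbelianization G)) :
    Module.IsTorsionFree ℤ_[ℓ] (V ℓ G) := by
  refine Module.IsTorsionFree.of_smul_eq_zero fun a v h => or_iff_not_imp_left.2 fun ha => ?_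
  obtain ⟨g, rfl⟩ := groupToV_surjective v
  rw [PadicInt.unitCoeff_spec ha, mul_smul] at h
  have h1 : (ℓ ^ a.valuation : ℕ) • groupToV ℓ g = 0 := by
    rw [← Nat.cast_smul_eq_nsmul ℤ_[ℓ], Nat.cast_pow]
    exact (PadicInt.unitCoeff ha).isUnit.smul_eq_zero.1 h
  rw [← groupToV_pow] at h1
  have h2 := mem_closure_commutator_of_groupToV_eq_zero hproEll h1
  refine groupToV_eq_zero_of_mem ((QuotientGroup.eq_one_iff g).1 ?_)
  refine htf.pow_left_injective (pow_ne_zero a.valuation (Fact.out : ℓ.Prime).ne_zero) ?_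
  change ((g : TopologicalAbelianization G)) ^ _ = 1 ^ _
  rw [one_pow]
  exact (QuotientGroup.eq_one_iff _).2 h2

end Freeness

/-! ### The quotient `U / W` has no `2`-torsion -/

section TwoTorsion

variable {ℓ : ℕ} [Fact ℓ.Prime]

theorem isOpen_span_pow (n : ℕ) :
    IsOpen ((Ideal.span {(ℓ : ℤ_[ℓ]) ^ n} : Ideal ℤ_[ℓ]) : Set ℤ_[ℓ]) := by
  have h : ((Ideal.span {(ℓ : ℤ_[ℓ]) ^ n} : Ideal ℤ_[ℓ]) : Set ℤ_[ℓ]) =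
      Metric.closedBall 0 ((ℓ : ℝ) ^ (-n : ℤ)) := by
    ext x
    rw [mem_closedBall_zero_iff, PadicInt.norm_le_pow_iff_mem_span_pow]
    rfl
  rw [h]
  refine IsUltrametricDist.isOpen_closedBall _ (zpow_ne_zero _ ?_)
  exact_mod_cast (Fact.out : ℓ.Prime).ne_zero

theorem eq_zero_of_forall_mem_span_pow {x : ℤ_[ℓ]}
    (h : ∀ n : ℕ, x ∈ (Ideal.span {(ℓ : ℤ_[ℓ]) ^ n} : Ideal ℤ_[ℓ])) : x = 0 := by
  by_contra hx
  have := (PadicInt.mem_span_pow_iff_le_valuation x hx (x.valuation + 1)).1 (h _)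
  omega

variable {G : Type u} [Group G] [TopologicalSpace G] [IsTopologicalGroup G] [CompactSpace G]
  [TopologicallyFG G]

/-- The open normal subgroup of the elements on which a linear functional on `V` vanishes
modulo `ℓ ^ n`. -/
def functionalKernel (a : V ℓ G →ₗ[ℤ_[ℓ]] ℤ_[ℓ]) (n : ℕ) : OpenNormalSubgroup G where
  carrier := {g | a (groupToV ℓ g) ∈ (Ideal.span {(ℓ : ℤ_[ℓ]) ^ n} : Ideal ℤ_[ℓ])}
  one_mem' := by
    change a (groupToV ℓ 1) ∈ (Ideal.span {(ℓ : ℤ_[ℓ]) ^ n} : Ideal ℤ_[ℓ])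
    rw [groupToV_one, map_zero]
    exact Submodule.zero_mem _
  mul_mem' {g h} hg hh := by
    change a (groupToV ℓ (g * h)) ∈ (Ideal.span {(ℓ : ℤ_[ℓ]) ^ n} : Ideal ℤ_[ℓ])
    rw [groupToV_mul, map_add]
    exact add_mem hg hh
  inv_mem' {g} hg := by
    change a (groupToV ℓ g⁻¹) ∈ (Ideal.span {(ℓ : ℤ_[ℓ]) ^ n} : Ideal ℤ_[ℓ])
    rw [groupToV_inv, map_neg]
    exact neg_mem hg
  isOpen' := (isOpen_span_pow n).preimage
    ((continuous_linearMap_of_finite a).comp continuous_groupToV)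
  isNormal' := ⟨fun g hg h => by
    change a (groupToV ℓ (h * g * h⁻¹)) ∈ (Ideal.span {(ℓ : ℤ_[ℓ]) ^ n} : Ideal ℤ_[ℓ])
    rw [groupToV_mul, groupToV_mul, groupToV_inv, add_comm (groupToV ℓ h), add_neg_cancel_right]
    exact hg⟩

/-- The value of a linear functional on `V` modulo `ℓ ^ n`, on a finite quotient of `G`. -/
noncomputable def functionalMod (a : V ℓ G →ₗ[ℤ_[ℓ]] ℤ_[ℓ]) (n : ℕ) {N : OpenNormalSubgroup G}
    (hN : N ≤ functionalKernel a n) :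
    G ⧸ N.toSubgroup → ℤ_[ℓ] ⧸ (Ideal.span {(ℓ : ℤ_[ℓ]) ^ n} : Ideal ℤ_[ℓ]) :=
  Quotient.lift (fun g => Ideal.Quotient.mk _ (a (groupToV ℓ g))) fun g h hgh => by
    have h1 : a (groupToV ℓ (g⁻¹ * h)) ∈ (Ideal.span {(ℓ : ℤ_[ℓ]) ^ n} : Ideal ℤ_[ℓ]) :=
      hN (QuotientGroup.leftRel_apply.1 hgh)
    rw [groupToV_mul, groupToV_inv, map_add, map_neg, neg_add_eq_sub] at h1
    exact (Ideal.Quotient.eq.2 h1).symm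

theorem functionalMod_mk (a : V ℓ G →ₗ[ℤ_[ℓ]] ℤ_[ℓ]) (n : ℕ) {N : OpenNormalSubgroup G}
    (hN : N ≤ functionalKernel a n) (g : G) :
    functionalMod a n hN (g : G ⧸ N.toSubgroup) = Ideal.Quotient.mk _ (a (groupToV ℓ g)) := rfl

theorem functionalMod_mul (a : V ℓ G →ₗ[ℤ_[ℓ]] ℤ_[ℓ]) (n : ℕ) {N : OpenNormalSubgroup G}
    (hN : N ≤ functionalKernel a n) (p q : G ⧸ N.toSubgroup) :
    functionalMod a n hN (p * q) = functionalMod a n hN p + functionalMod a n hN q := by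
  induction p using QuotientGroup.induction_on with
  | H g =>
    induction q using QuotientGroup.induction_on with
    | H h =>
      rw [← QuotientGroup.mk_mul, functionalMod_mk, functionalMod_mk, functionalMod_mk,
        groupToV_mul, map_add, map_add]

/-- The symmetrization of `a ⊗ b` descends to `U` modulo every power of `ℓ`. -/
theorem exists_functional_mulTensor (a b : V ℓ G →ₗ[ℤ_[ℓ]] ℤ_[ℓ]) (n : ℕ) :
    ∃ Φ : U ℓ G →ₗ[ℤ_[ℓ]] ℤ_[ℓ] ⧸ (Ideal.span {(ℓ : ℤ_[ℓ]) ^ n} : Ideal ℤ_[ℓ]),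
      ∀ t, Φ (mulTensor ℓ G t) = Ideal.Quotient.mk _ (LinearMap.mul' ℤ_[ℓ] ℤ_[ℓ]
        (TensorProduct.map a b (t + TensorProduct.comm _ _ _ t))) := by
  -- Modulo `ℓ ^ n` both functionals factor through a finite quotient of `G`, where linear extension
  -- to the group algebra is available.
  let N : OpenNormalSubgroup G := functionalKernel a n ⊓ functionalKernel b n
  let α := functionalMod a n (N := N) inf_le_left
  let β := functionalMod b n (N := N) inf_le_right
  have hα : ∀ p q, α (p * q) = α p + α q := functionalMod_mul a n _
  have hβ : ∀ p q, β (p * q) = β p + β q := functionalMod_mul b n _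
  let S := linearExtension (R := ℤ_[ℓ]) (fun q => α q * β q) ∘ₗ (proj ℓ N).toLinearMap
  have hS {x y : CompletedGroupRing ℓ G} (hx : augmentation ℓ G x = 0)
      (hy : augmentation ℓ G y = 0) : S (x * y) =
        linearExtension α (proj ℓ N x) * linearExtension β (proj ℓ N y) +
        linearExtension α (proj ℓ N y) * linearExtension β (proj ℓ N x) := by
    change linearExtension _ (proj ℓ N (x * y)) = _
    rw [map_mul, linearExtension_mul_mul hα hβ, lift_one_proj, lift_one_proj, hx, hy]
    simp
  -- Every term of the formula `hS` contains the extension of `α` or `β` evaluated at the factor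
  -- from `I²`, where it vanishes.
  have hS3 : ∀ x ∈ augIdeal ℓ G ^ 3, S x = 0 := by
    intro x hx
    rw [pow_succ _ 2] at hx
    induction hx using Submodule.mul_induction_on' with
    | mem_mul_mem x hx y hy =>
      rw [hS (augIdeal_sq_le hx) hy, linearExtension_proj_eq_zero hα hx,
        linearExtension_proj_eq_zero hβ hx, zero_mul, mul_zero, add_zero]
    | add x _ y _ hx hy => rw [map_add, hx, hy, add_zero]
  let Φ : U ℓ G →ₗ[ℤ_[ℓ]] ℤ_[ℓ] ⧸ (Ideal.span {(ℓ : ℤ_[ℓ]) ^ n} : Ideal ℤ_[ℓ]) :=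
    AugQuot.lift (S ∘ₗ (augIdeal ℓ G ^ 2).subtype) fun x hx => hS3 x.1 hx
  have key : Φ ∘ₗ mulTensor ℓ G = (Ideal.Quotient.mkₐ ℤ_[ℓ] _).toLinearMap ∘ₗ
      LinearMap.mul' ℤ_[ℓ] ℤ_[ℓ] ∘ₗ TensorProduct.map a b ∘ₗ
      (LinearMap.id + (TensorProduct.comm _ _ _).toLinearMap) := by
    refine TensorProduct.ext (LinearMap.ext_on span_range_groupToV ?_)
    rintro _ ⟨g, rfl⟩
    refine LinearMap.ext_on span_range_groupToV ?_
    rintro _ ⟨h, rfl⟩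
    have e (F : G ⧸ N.toSubgroup → ℤ_[ℓ] ⧸ (Ideal.span {(ℓ : ℤ_[ℓ]) ^ n} : Ideal ℤ_[ℓ]))
        (hF : ∀ p q, F (p * q) = F p + F q) (g : G) :
        linearExtension F (proj ℓ N (of ℓ g - 1)) = F g := by
      have h1 : F 1 = 0 := by simpa using hF 1 1
      rw [map_sub, map_sub, map_one, proj_of, MonoidAlgebra.one_def, linearExtension_single,
        linearExtension_single, h1, one_smul, one_smul, sub_zero]
    have h1 : Φ (mulTensor ℓ G (groupToV ℓ g ⊗ₜ groupToV ℓ h)) =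
        S ((of ℓ g - 1) * (of ℓ h - 1)) := by
      rw [mulTensor, TensorProduct.lift.tmul, groupToV, groupToV, mulV_mk]
      rfl
    have h2 : S ((of ℓ g - 1) * (of ℓ h - 1)) = α g * β h + α h * β g := by
      rw [hS (of_sub_one_mem g) (of_sub_one_mem h), e α hα, e α hα, e β hβ, e β hβ]
    change Φ (mulTensor ℓ G (groupToV ℓ g ⊗ₜ groupToV ℓ h)) = Ideal.Quotient.mk _
      (LinearMap.mul' ℤ_[ℓ] ℤ_[ℓ] (TensorProduct.map a b (groupToV ℓ g ⊗ₜ groupToV ℓ h +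
        TensorProduct.comm _ _ _ (groupToV ℓ g ⊗ₜ groupToV ℓ h))))
    rw [h1, h2, TensorProduct.comm_tmul, map_add, TensorProduct.map_tmul, TensorProduct.map_tmul,
      map_add, LinearMap.mul'_apply, LinearMap.mul'_apply, map_add, map_mul, map_mul]
    rfl
  exact ⟨Φ, fun t => LinearMap.congr_fun key t⟩

/-- Write `u` as the image of `t` and `2u` as the image of an alternating `s`. The symmetrized
functionals descend to `U` and vanish on `s`, so they give twice the pairing of `t + ι t` with every
`a ⊗ b` as zero. Thus `t` itself is alternating. -/
theorem mem_W_of_two_smul_mem [Module.Free ℤ_[ℓ] (V ℓ G)] {u : U ℓ G}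
    (hu : (2 : ℤ_[ℓ]) • u ∈ W ℓ G) : u ∈ W ℓ G := by
  obtain ⟨t, rfl⟩ := mulTensor_surjective u
  refine ⟨t, ?_, rfl⟩
  obtain ⟨s, hs, hst⟩ := hu
  have hs0 : s + TensorProduct.comm ℤ_[ℓ] (V ℓ G) (V ℓ G) s = 0 := by
    have : TensorProduct.comm ℤ_[ℓ] (V ℓ G) (V ℓ G) s = -s := hs
    rw [this, add_neg_cancel]
  have hpair (a b : V ℓ G →ₗ[ℤ_[ℓ]] ℤ_[ℓ]) : LinearMap.mul' ℤ_[ℓ] ℤ_[ℓ]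
      (TensorProduct.map a b (t + TensorProduct.comm ℤ_[ℓ] (V ℓ G) (V ℓ G) t)) = 0 := by
    -- The relation is known modulo each `ℓ ^ n` only; it is carried with its factor `2`, which is
    -- cancelled in the domain `ℤ_ℓ` at the end, so `ℓ = 2` needs no separate treatment.
    refine (mul_eq_zero.1 (eq_zero_of_forall_mem_span_pow (x := 2 * _) fun n => ?_)).resolve_left
      two_ne_zero
    obtain ⟨Φ, hΦ⟩ := exists_functional_mulTensor a b n
    have h := hΦ s
    rw [hs0, hst, map_smul, hΦ, map_zero, map_zero, map_zero] at h
    rw [← Ideal.Quotient.eq_zero_iff_mem, map_mul]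
    rwa [Algebra.smul_def] at h
  let B := Module.Free.chooseBasis ℤ_[ℓ] (V ℓ G)
  have hzero : t + TensorProduct.comm ℤ_[ℓ] (V ℓ G) (V ℓ G) t = 0 := by
    -- The functionals `B.coord i ⊗ B.coord j` read off the coordinates in the tensor basis.
    refine (B.tensorProduct B).repr.injective (Finsupp.ext fun ⟨i, j⟩ => ?_)
    rw [map_zero, Finsupp.zero_apply, ← hpair (B.coord i) (B.coord j)]
    generalize t + TensorProduct.comm ℤ_[ℓ] (V ℓ G) (V ℓ G) t = r
    induction r using TensorProduct.induction_on with
    | zero => simp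
    | tmul x y => simp [mul_comm]
    | add x y hx hy => rw [map_add, map_add, map_add, Finsupp.add_apply, hx, hy]
  exact (neg_eq_of_add_eq_zero_right hzero).symm

end TwoTorsion

/-! ### Generalities on first cohomology -/

section Cohomology

variable {k Γ M : Type*} [CommRing k] [Group Γ] [TopologicalSpace Γ]
  [AddCommGroup M] [Module k M] [TopologicalSpace M] [IsTopologicalAddGroup M]
  {ρ : Representation k Γ M}

theorem H1.mk_surjective : Function.Surjective (H1.mk (ρ := ρ)) := QuotientAddGroup.mk'_surjective _

theorem H1.mk_eq_zero {z : Z1 ρ} : H1.mk z = 0 ↔ ∃ m, ∀ g, z.1 g = ρ g m - m :=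
  QuotientAddGroup.eq_zero_iff z

theorem H1.mk_eq_mk {z z' : Z1 ρ} :
    H1.mk z = H1.mk z' ↔ ∃ m, ∀ g, z.1 g - z'.1 g = ρ g m - m := by
  rw [← sub_eq_zero, ← map_sub, H1.mk_eq_zero]
  rfl

/-- A cocycle that vanishes on a normal subgroup acting trivially descends to the quotient. -/
theorem exists_Z1_ofQuotient (S : Subgroup Γ) [S.Normal]
    [Representation.IsTrivial (ρ.comp S.subtype)] (z : Z1 ρ) (hz : ∀ s ∈ S, z.1 s = 0) :
    ∃ y : Z1 (ρ.ofQuotient S), ∀ g : Γ, y.1 (g : Γ ⧸ S) = z.1 g := by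
  have h (g h : Γ) (H : QuotientGroup.leftRel S g h) : z.1 g = z.1 h := by
    have h1 := z.2.2 g (g⁻¹ * h)
    rw [mul_inv_cancel_left, hz _ (QuotientGroup.leftRel_apply.1 H), map_zero, add_zero] at h1
    exact h1.symm
  refine ⟨⟨Quotient.lift z.1 h, continuous_quot_lift _ z.2.1, fun p q => ?_⟩, fun _ => rfl⟩
  induction p using QuotientGroup.induction_on with
  | H p =>
    induction q using QuotientGroup.induction_on with
    | H q => exact z.2.2 p q

end Cohomology

/-! ### The extension `0 → U → E → V → 0` -/

section Extension

variable {ℓ : ℕ} [Fact ℓ.Prime] {G : Type u} [Group G] [TopologicalSpace G]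

theorem inclUE_mk (x : ↥(augIdeal ℓ G ^ 2)) : inclUE ℓ G (AugQuot.mk ℓ G 2 3 x) =
    AugQuot.mk ℓ G 1 3 (Submodule.inclusion (augIdeal_pow_succ_le 0) x) := rfl

theorem projEV_mk (x : ↥(augIdeal ℓ G ^ 1)) :
    projEV ℓ G (AugQuot.mk ℓ G 1 3 x) = AugQuot.mk ℓ G 1 2 x := rfl

theorem inclUE_injective : Function.Injective (inclUE ℓ G) := by
  refine (injective_iff_map_eq_zero _).2 fun u hu => ?_
  obtain ⟨x, rfl⟩ := AugQuot.mk_surjective u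
  rw [inclUE_mk, AugQuot.mk_eq_zero] at hu
  exact AugQuot.mk_eq_zero.2 hu

theorem projEV_surjective : Function.Surjective (projEV ℓ G) := fun v => by
  obtain ⟨x, rfl⟩ := AugQuot.mk_surjective v
  exact ⟨AugQuot.mk ℓ G 1 3 x, rfl⟩

theorem exists_inclUE_eq {e : E ℓ G} (he : projEV ℓ G e = 0) : ∃ u, inclUE ℓ G u = e := by
  obtain ⟨x, rfl⟩ := AugQuot.mk_surjective e
  rw [projEV_mk, AugQuot.mk_eq_zero] at he
  exact ⟨AugQuot.mk ℓ G 2 3 ⟨x.1, he⟩, rfl⟩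

theorem augRep_inclUE (σ : ContAut G) (u : U ℓ G) :
    augRep ℓ G 1 3 σ (inclUE ℓ G u) = inclUE ℓ G (augRep ℓ G 2 3 σ u) := by
  obtain ⟨x, rfl⟩ := AugQuot.mk_surjective u
  rw [inclUE_mk, augRep_mk, augRep_mk, inclUE_mk]
  rfl

theorem projEV_augRep (σ : ContAut G) (e : E ℓ G) :
    projEV ℓ G (augRep ℓ G 1 3 σ e) = augRep ℓ G 1 2 σ (projEV ℓ G e) := by
  obtain ⟨x, rfl⟩ := AugQuot.mk_surjective e
  rw [augRep_mk, projEV_mk, projEV_mk, augRep_mk]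

theorem augRep_apply_inv (m n : ℕ) (σ : ContAut G) (x : AugQuot ℓ G m n) :
    augRep ℓ G m n σ (augRep ℓ G m n σ⁻¹ x) = x := by
  rw [← Module.End.mul_apply, ← map_mul, mul_inv_cancel, map_one, Module.End.one_apply]

theorem augRep_mul (m n : ℕ) (σ τ : ContAut G) (x : AugQuot ℓ G m n) :
    augRep ℓ G m n (σ * τ) x = augRep ℓ G m n σ (augRep ℓ G m n τ x) := by
  rw [map_mul, Module.End.mul_apply]

/-- A linear map into `E` with values in `U` factors through `U`. -/
theorem exists_linearMap_inclUE {P : Type*} [AddCommGroup P] [Module ℤ_[ℓ] P]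
    (d : P →ₗ[ℤ_[ℓ]] E ℓ G) (hd : ∀ v, projEV ℓ G (d v) = 0) :
    ∃ t : P →ₗ[ℤ_[ℓ]] U ℓ G, ∀ v, inclUE ℓ G (t v) = d v := by
  refine ⟨(LinearEquiv.ofInjective _ inclUE_injective).symm.toLinearMap ∘ₗ
    d.codRestrict (LinearMap.range (inclUE ℓ G)) fun v => exists_inclUE_eq (hd v), fun v => ?_⟩
  exact congrArg Subtype.val (LinearEquiv.apply_symm_apply
    (LinearEquiv.ofInjective (inclUE ℓ G) inclUE_injective) _)

/-- An inner automorphism acts on `E` through the commutator map. -/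
theorem augRep_conj_sub [IsTopologicalGroup G] (g : G) (e : E ℓ G) :
    augRep ℓ G 1 3 (conj g) e - e =
      inclUE ℓ G (commutatorMap ℓ G (groupToV ℓ g) (projEV ℓ G e)) := by
  obtain ⟨x, rfl⟩ := AugQuot.mk_surjective e
  rw [projEV_mk, groupToV, commutatorMap_apply, mulV_mk, mulV_mk, ← map_sub, inclUE_mk,
    augRep_mk, ← map_sub, ← sub_eq_zero, ← map_sub]
  refine AugQuot.mk_eq_zero.2 ?_
  change CompletedGroupRing.map (conj g) x.1 - x.1 -
    ((of ℓ g - 1) * x.1 - x.1 * (of ℓ g - 1)) ∈ augIdeal ℓ G ^ 3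
  have hgb : of ℓ g * of ℓ g⁻¹ = 1 := by rw [← map_mul, mul_inv_cancel, map_one]
  have key : CompletedGroupRing.map (conj g) x.1 - x.1 -
      ((of ℓ g - 1) * x.1 - x.1 * (of ℓ g - 1)) =
      ((of ℓ g - 1) * x.1 - x.1 * (of ℓ g - 1)) * (of ℓ g⁻¹ - 1) := by
    have h : CompletedGroupRing.map (conj g) x.1 - x.1 =
        of ℓ g * x.1 * of ℓ g⁻¹ - x.1 * (of ℓ g * of ℓ g⁻¹) := by
      rw [hgb, mul_one, map_conj]
    rw [h]
    noncomm_ring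
  rw [key]
  have hg := of_sub_one_mem_pow_one ℓ g
  exact mul_mem_pow (m := 2) (n := 1) (sub_mem (mul_mem_pow hg x.2) (mul_mem_pow x.2 hg))
    (of_sub_one_mem_pow_one ℓ _)

variable [IsTopologicalGroup G] [CompactSpace G] [TopologicallyFG G]

/-- `U` is compact and `E` is Hausdorff. The section cocycle is given by a formula in `E`, and this
transfers its continuity to `U`. -/
theorem isInducing_inclUE : IsInducing (inclUE ℓ G) := by
  have hc : Continuous (inclUE ℓ G) := continuous_linearMap_of_finite _
  exact (hc.isClosedEmbedding inclUE_injective).isInducing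

theorem continuous_conj_linearMap {m n : ℕ} (t : V ℓ G →ₗ[ℤ_[ℓ]] AugQuot ℓ G m n) (v : V ℓ G) :
    Continuous fun σ : ContAut G => augRep ℓ G m n σ (t (augRep ℓ G 1 2 σ⁻¹ v)) := by
  have ht : Continuous t := continuous_linearMap_of_finite t
  have h : Continuous fun σ : ContAut G => (σ, t (augRep ℓ G 1 2 σ⁻¹ v)) :=
    continuous_id.prodMk (ht.comp (continuous_augRep_inv ℓ 1 2 v))
  simpa only [Function.comp_def] using (continuous_augRep (G := G) ℓ m n).comp h

/-- The coboundary of `t ∈ Hom(V, U)`, as a continuous cocycle. -/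
noncomputable def coboundary (t : HomVU ℓ G) : Z1 (repHomVU ℓ G) :=
  ⟨fun σ => repHomVU ℓ G σ t - t,
    continuous_induced_rng.2 (continuous_pi fun v =>
      (continuous_conj_linearMap t v).sub continuous_const),
    fun σ τ => by
      change repHomVU ℓ G (σ * τ) t - t =
        repHomVU ℓ G σ t - t + repHomVU ℓ G σ (repHomVU ℓ G τ t - t)
      rw [map_mul, Module.End.mul_apply, map_sub]
      abel⟩

end Extension

/-! ### The inclusion of `Hom(V, W)` in `Hom(V, U)` -/

section Inclusion

variable {ℓ : ℕ} [Fact ℓ.Prime] {G : Type u} [Group G] [TopologicalSpace G]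

theorem exists_Z1_repHomVW {z : Z1 (repHomVU ℓ G)} (hz : ∀ τ v, z.1 τ v ∈ W ℓ G) :
    ∃ y : Z1 (repHomVW ℓ G), ∀ τ, inclHom ℓ G (y.1 τ) = z.1 τ := by
  refine ⟨⟨fun τ => (z.1 τ).codRestrict _ (hz τ), ?_, fun τ τ' => LinearMap.ext fun v =>
    Subtype.ext (LinearMap.congr_fun (z.2.2 τ τ') v)⟩, fun τ => rfl⟩
  exact continuous_induced_rng.2 (continuous_pi fun v =>
    ((continuous_linearMap_apply v).comp z.2.1).subtype_mk _)

theorem exists_inclHom_eq {f : HomVU ℓ G} (hf : ∀ v, f v ∈ W ℓ G) : ∃ h, inclHom ℓ G h = f :=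
  ⟨f.codRestrict _ hf, rfl⟩

theorem inclHom_injective : Function.Injective (inclHom ℓ G) := fun _ _ h =>
  LinearMap.ext fun v => Subtype.ext (LinearMap.congr_fun h v)

theorem inclA_injective : Function.Injective (inclA ℓ G) := by
  refine (injective_iff_map_eq_zero _).2 fun x hx => ?_
  induction x using Submodule.Quotient.induction_on with
  | H f =>
    obtain ⟨v, hv⟩ := (Submodule.Quotient.mk_eq_zero _).1 hx
    exact (Submodule.Quotient.mk_eq_zero _).2 ⟨v, inclHom_injective hv⟩

end Inclusion

/-! ### The modified diagonal class and the Johnson class -/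

section Classes

variable {ℓ : ℕ} [Fact ℓ.Prime] {G : Type u} [Group G] [TopologicalSpace G]

/-- `z` is the cocycle `σ ↦ σ s σ⁻¹ - s` attached to the section `s`. -/
def IsSectionCocycle (s : V ℓ G →ₗ[ℤ_[ℓ]] E ℓ G) (z : Z1 (repHomVU ℓ G)) : Prop :=
  ∀ σ v, inclUE ℓ G (z.1 σ v) = augRep ℓ G 1 3 σ (s (augRep ℓ G 1 2 σ⁻¹ v)) - s v

/-- Two sections differ by a map `t : V → U`, whose coboundary is the difference of the cocycles. -/
theorem isModifiedDiagonalClass_unique {c c' : H1 (repHomVU ℓ G)}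
    (hc : IsModifiedDiagonalClass ℓ G c) (hc' : IsModifiedDiagonalClass ℓ G c') : c = c' := by
  obtain ⟨s, z, hs, hz, rfl⟩ := hc
  obtain ⟨s', z', hs', hz', rfl⟩ := hc'
  obtain ⟨t, ht⟩ := exists_linearMap_inclUE (s - s') fun v => by
    rw [LinearMap.sub_apply, map_sub, hs, hs', sub_self]
  refine H1.mk_eq_mk.2 ⟨t, fun σ => LinearMap.ext fun v => inclUE_injective ?_⟩
  rw [LinearMap.sub_apply, LinearMap.sub_apply, repHomVU_apply, map_sub, map_sub, hz, hz',
    ← augRep_inclUE, ht, ht, LinearMap.sub_apply, LinearMap.sub_apply, map_sub]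
  abel

variable [IsTopologicalGroup G]

/-- The coefficients are the same module, so an element trivializing the inflated cocycle already
trivializes it on `Out(G)`. -/
theorem inflation_injective : Function.Injective (inflation ℓ G) := by
  refine (injective_iff_map_eq_zero _).2 fun j hj => ?_
  obtain ⟨z, rfl⟩ := H1.mk_surjective j
  obtain ⟨m, hm⟩ := H1.mk_eq_zero.1 hj
  refine H1.mk_eq_zero.2 ⟨m, fun g => ?_⟩
  induction g using QuotientGroup.induction_on with
  | H σ => exact hm σ

theorem IsSectionCocycle.apply_conj {s : V ℓ G →ₗ[ℤ_[ℓ]] E ℓ G} {z : Z1 (repHomVU ℓ G)}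
    (hz : IsSectionCocycle s z) (hs : ∀ v, projEV ℓ G (s v) = v) (g : G) :
    z.1 (conj g) = commutatorMap ℓ G (groupToV ℓ g) := by
  refine LinearMap.ext fun v => inclUE_injective ?_
  rw [hz, ← map_inv, augRep_conj 1, augRep_conj_sub, hs]

/-- By `IsSectionCocycle.apply_conj`, the section cocycle takes inner automorphisms into the range
of the commutator map, so it vanishes on them in `A(G)` and descends. -/
theorem exists_isJohnsonClass {c : H1 (repHomVU ℓ G)} (hc : IsModifiedDiagonalClass ℓ G c) :
    ∃ j, IsJohnsonClass ℓ G j := by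
  have hc' := hc
  obtain ⟨s, z, hs, hz, rfl⟩ := hc
  obtain ⟨zA, hzA⟩ : ∃ zA : Z1 (repA ℓ G), ∀ σ, zA.1 σ = Submodule.Quotient.mk (z.1 σ) :=
    ⟨⟨fun σ => Submodule.Quotient.mk (z.1 σ), continuous_quot_mk.comp z.2.1, fun σ τ =>
      congrArg Submodule.Quotient.mk (z.2.2 σ τ)⟩, fun _ => rfl⟩
  obtain ⟨y, hy⟩ := exists_Z1_ofQuotient (Inn G) zA (by
    rintro _ ⟨g, rfl⟩
    rw [hzA, IsSectionCocycle.apply_conj hz hs]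
    exact (Submodule.Quotient.mk_eq_zero _).2 ⟨_, rfl⟩)
  refine ⟨H1.mk y, _, hc', H1.mk_eq_mk.2 ⟨0, fun σ => ?_⟩⟩
  rw [map_zero, sub_zero, sub_eq_zero]
  exact (hy σ).trans (hzA σ)

theorem isJohnsonClass_unique {j j' : H1 (repAOut ℓ G)} (hj : IsJohnsonClass ℓ G j)
    (hj' : IsJohnsonClass ℓ G j') : j = j' := by
  obtain ⟨c, hc, h⟩ := hj
  obtain ⟨c', hc', h'⟩ := hj'
  rw [isModifiedDiagonalClass_unique hc' hc] at h'
  exact inflation_injective (h.trans h'.symm)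

variable [CompactSpace G] [TopologicallyFG G]

theorem exists_isModifiedDiagonalClass [Module.Free ℤ_[ℓ] (V ℓ G)] :
    ∃ c, IsModifiedDiagonalClass ℓ G c := by
  obtain ⟨s, hs⟩ := Module.projective_lifting_property (projEV ℓ G) LinearMap.id projEV_surjective
  have hs' (v) : projEV ℓ G (s v) = v := LinearMap.congr_fun hs v
  have h (σ : ContAut G) := exists_linearMap_inclUE
    (augRep ℓ G 1 3 σ ∘ₗ s ∘ₗ augRep ℓ G 1 2 σ⁻¹ - s) fun v => by
      simp only [LinearMap.sub_apply, LinearMap.comp_apply, map_sub, projEV_augRep, hs',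
        augRep_apply_inv, sub_self]
  choose f hf using h
  have hf' (σ v) : inclUE ℓ G (f σ v) = augRep ℓ G 1 3 σ (s (augRep ℓ G 1 2 σ⁻¹ v)) - s v := hf σ v
  refine ⟨_, s, ⟨f, ?_, fun σ τ => LinearMap.ext fun v => inclUE_injective ?_⟩, hs', hf', rfl⟩
  · refine continuous_induced_rng.2 (continuous_pi fun v => isInducing_inclUE.continuous_iff.2 ?_)
    exact ((continuous_conj_linearMap s v).sub continuous_const).congr fun σ => (hf' σ v).symm
  · rw [LinearMap.add_apply, map_add, repHomVU_apply, ← augRep_inclUE, hf', hf', hf', map_sub,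
      mul_inv_rev, augRep_mul, augRep_mul]
    abel

end Classes

/-! ### An automorphism acting by `-1` -/

section Inversion

variable {ℓ : ℕ} [Fact ℓ.Prime] {G : Type u} [Group G] [TopologicalSpace G] [IsTopologicalGroup G]

/-- `σ` acts as inversion on the topological abelianization of `G`. -/
def ActsByInversion (σ : ContAut G) : Prop :=
  ∀ g : G, ((σ g : G) : TopologicalAbelianization G) = ((g : G) : TopologicalAbelianization G)⁻¹

theorem ContAut.map_mem_closure_commutator (τ : ContAut G) {c : G}
    (hc : c ∈ (commutator G).topologicalClosure) : τ c ∈ (commutator G).topologicalClosure := by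
  have hle : commutator G ≤ (commutator G).topologicalClosure.comap (τ : G →* G) :=
    Subgroup.commutator_le.2 fun a _ b _ => by
      rw [Subgroup.mem_comap, map_commutatorElement]
      exact Subgroup.le_topologicalClosure _
        (Subgroup.commutator_mem_commutator (Subgroup.mem_top _) (Subgroup.mem_top _))
  exact Subgroup.topologicalClosure_minimal _ hle
    ((Subgroup.isClosed_topologicalClosure _).preimage τ.continuous) hc

/-- Inversion commutes with every automorphism of the abelianization. -/
theorem ActsByInversion.conjugate {σ : ContAut G} (hσ : ActsByInversion σ) (τ : ContAut G) :
    ActsByInversion (τ * σ * τ⁻¹) := fun g => by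
  have h1 : (σ (τ⁻¹ g))⁻¹ * (τ⁻¹ g)⁻¹ ∈ (commutator G).topologicalClosure :=
    QuotientGroup.eq.1 (hσ (τ⁻¹ g))
  have h2 := τ.map_mem_closure_commutator h1
  rw [map_mul, map_inv, map_inv, ContAut.apply_inv_apply] at h2
  exact QuotientGroup.eq.2 h2

variable [CompactSpace G] [TopologicallyFG G] {σ : ContAut G}

theorem ActsByInversion.augRep_V (hσ : ActsByInversion σ) (v : V ℓ G) :
    augRep ℓ G 1 2 σ v = -v := by
  obtain ⟨g, rfl⟩ := groupToV_surjective v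
  rw [augRep_groupToV, groupToV_congr (h := g⁻¹) (hσ g), groupToV_inv]

theorem ActsByInversion.augRep_U (hσ : ActsByInversion σ) (u : U ℓ G) :
    augRep ℓ G 2 3 σ u = u := by
  obtain ⟨t, rfl⟩ := mulTensor_surjective u
  induction t using TensorProduct.induction_on with
  | zero => simp
  | tmul x y => simp [mulTensor, augRep_mulV, hσ.augRep_V]
  | add a b ha hb => rw [map_add, map_add, ha, hb]

theorem ActsByInversion.repHomVU_apply (hσ : ActsByInversion σ) (f : HomVU ℓ G) (v : V ℓ G) :
    repHomVU ℓ G σ f v = -f v := by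
  have h : augRep ℓ G 1 2 σ⁻¹ v = -v := by
    rw [← neg_eq_iff_eq_neg, ← hσ.augRep_V (augRep ℓ G 1 2 σ⁻¹ v), augRep_apply_inv]
  rw [ProEll.repHomVU_apply, hσ.augRep_U, h, map_neg]

/-- Since `G → V` is onto, `e` is the class of some `[g] - 1` plus an element of `U`. Both
automorphisms fix the latter, and `σ g`, `τ g` agree in the abelianization. -/
theorem ActsByInversion.augRep_sub_mem (hσ : ActsByInversion σ) {τ : ContAut G}
    (hτ : ActsByInversion τ) (e : E ℓ G) :
    ∃ w ∈ W ℓ G, inclUE ℓ G w = augRep ℓ G 1 3 σ e - augRep ℓ G 1 3 τ e := by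
  obtain ⟨g, hg⟩ := groupToV_surjective (projEV ℓ G e)
  obtain ⟨u, hu⟩ := exists_inclUE_eq (e := e - AugQuot.mk ℓ G 1 3 ⟨_, of_sub_one_mem_pow_one ℓ g⟩)
    (by rw [map_sub, projEV_mk, ← hg, groupToV, sub_self])
  have he : e = inclUE ℓ G u + AugQuot.mk ℓ G 1 3 ⟨_, of_sub_one_mem_pow_one ℓ g⟩ := by
    rw [hu, sub_add_cancel]
  have hw : of ℓ (σ g) - of ℓ (τ g) ∈ preimageW ℓ G :=
    of_sub_of_mem_preimageW ((hσ g).trans (hτ g).symm)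
  refine ⟨_, (mem_preimageW (preimageW_le hw)).1 hw, ?_⟩
  rw [he, map_add, map_add, augRep_inclUE, augRep_inclUE, hσ.augRep_U, hτ.augRep_U,
    add_sub_add_left_eq_sub, augRep_mk_of_sub_one, augRep_mk_of_sub_one, inclUE_mk,
    ← map_sub (AugQuot.mk ℓ G 1 3)]
  exact congrArg (AugQuot.mk ℓ G 1 3) (Subtype.ext (sub_sub_sub_cancel_right _ _ _).symm)

/-- Twice the cocycle of a section is cohomologous to a cocycle with values in `Hom(V, W)`. -/
theorem ActsByInversion.exists_coboundary (hσ : ActsByInversion σ) {s : V ℓ G →ₗ[ℤ_[ℓ]] E ℓ G}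
    {z : Z1 (repHomVU ℓ G)} (hz : IsSectionCocycle s z) (hs : ∀ v, projEV ℓ G (s v) = v) :
    ∃ t : HomVU ℓ G, ∀ τ v, (2 • z - coboundary t).1 τ v ∈ W ℓ G := by
  -- `s + σ s` projects to `v + (-v) = 0` in `V`, hence lands in `U`.
  obtain ⟨t, ht⟩ := exists_linearMap_inclUE (s + augRep ℓ G 1 3 σ ∘ₗ s) fun v => by
    rw [LinearMap.add_apply, LinearMap.comp_apply, map_add, projEV_augRep, hs, hσ.augRep_V,
      add_neg_cancel]
  have ht' (v) : inclUE ℓ G (t v) = s v + augRep ℓ G 1 3 σ (s v) := ht v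
  refine ⟨t, fun τ v => ?_⟩
  set e := augRep ℓ G 1 3 τ (s (augRep ℓ G 1 2 τ⁻¹ v)) with he
  obtain ⟨w, hw, hwe⟩ := hσ.augRep_sub_mem (hσ.conjugate τ) e
  have hze : inclUE ℓ G (z.1 τ v) = e - s v := hz τ v
  have h1 : augRep ℓ G 1 3 σ e = augRep ℓ G 1 3 σ (s v) + inclUE ℓ G (z.1 τ v) := by
    rw [← hσ.augRep_U (z.1 τ v), ← augRep_inclUE, hze, map_sub, add_sub_cancel]
  have h2 : augRep ℓ G 1 3 (τ * σ * τ⁻¹) e =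
      augRep ℓ G 1 3 τ (augRep ℓ G 1 3 σ (s (augRep ℓ G 1 2 τ⁻¹ v))) := by
    rw [he, ← augRep_mul, ← augRep_mul, inv_mul_cancel_right, augRep_mul]
  -- With `e = τ s τ⁻¹ v`, the left side expands to `e - s v + σ s v - τ σ s τ⁻¹ v`. As `σ` fixes `e
  -- - s v ∈ U`, the first three terms are `σ e`, and the last is `τ σ τ⁻¹ e`.
  have key : (2 • z - coboundary t).1 τ v = w := by
    refine inclUE_injective ?_
    have h3 : (2 • z - coboundary t).1 τ v =
        (2 : ℕ) • z.1 τ v - (augRep ℓ G 2 3 τ (t (augRep ℓ G 1 2 τ⁻¹ v)) - t v) := rfl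
    rw [h3, map_sub, map_sub, map_nsmul, ← augRep_inclUE, ht', ht', map_add, ← he, hwe, h1, h2,
      hze]
    abel
  rw [key]
  exact hw

/-- Here `σ f - f = -2f`, and `U / W` has no `2`-torsion. -/
theorem ActsByInversion.mem_W [Module.Free ℤ_[ℓ] (V ℓ G)] (hσ : ActsByInversion σ)
    {f : HomVU ℓ G} (hf : ∀ v, (repHomVU ℓ G σ f - f) v ∈ W ℓ G) (v : V ℓ G) : f v ∈ W ℓ G := by
  refine mem_W_of_two_smul_mem ?_
  have h := (W ℓ G).neg_mem (hf v)
  rwa [LinearMap.sub_apply, hσ.repHomVU_apply, neg_sub, sub_neg_eq_add, ← two_smul ℤ_[ℓ]] at h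

theorem ActsByInversion.coeffMapAut_injective [Module.Free ℤ_[ℓ] (V ℓ G)]
    (hσ : ActsByInversion σ) : Function.Injective (coeffMapAut ℓ G) := by
  refine (injective_iff_map_eq_zero _).2 fun x hx => ?_
  obtain ⟨y, rfl⟩ := H1.mk_surjective x
  obtain ⟨f, hf⟩ := H1.mk_eq_zero.1 hx
  have hf' (τ) : inclHom ℓ G (y.1 τ) = repHomVU ℓ G τ f - f := hf τ
  obtain ⟨h, rfl⟩ := exists_inclHom_eq (hσ.mem_W (f := f) fun v => by
    rw [← hf']
    exact (y.1 σ v).2)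
  refine H1.mk_eq_zero.2 ⟨h, fun τ => inclHom_injective ?_⟩
  rw [hf', map_sub, inclHom_rep]

/-- The trivializing element is known only modulo the commutator map, but that map has values in
`Hom(V, W)`. So the evaluation at `σ` still shows that a representative `f` is `W`-valued. -/
theorem ActsByInversion.coeffMapOut_injective [Module.Free ℤ_[ℓ] (V ℓ G)]
    (hσ : ActsByInversion σ) : Function.Injective (coeffMapOut ℓ G) := by
  refine (injective_iff_map_eq_zero _).2 fun x hx => ?_
  obtain ⟨y, rfl⟩ := H1.mk_surjective x
  obtain ⟨a, ha⟩ := H1.mk_eq_zero.1 hx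
  have ha' (τ : ContAut G) : inclA ℓ G (y.1 (τ : ContOut G)) = repA ℓ G τ a - a := ha τ
  obtain ⟨f, rfl⟩ := Submodule.Quotient.mk_surjective _ a
  obtain ⟨h, hh⟩ := Submodule.Quotient.mk_surjective _ (y.1 (σ : ContOut G))
  have hσf := ha' σ
  rw [← hh] at hσf
  obtain ⟨x, hx⟩ : inclHom ℓ G h - (repHomVU ℓ G σ f - f) ∈ LinearMap.range (commutatorMap ℓ G) :=
    (Submodule.Quotient.eq _).1 hσf
  obtain ⟨k, rfl⟩ := exists_inclHom_eq (hσ.mem_W (f := f) fun v => by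
    rw [← sub_sub_cancel (inclHom ℓ G h) (repHomVU ℓ G σ f - f), ← hx]
    exact sub_mem (h v).2 (commutatorMap_mem ℓ G x v))
  refine H1.mk_eq_zero.2 ⟨Submodule.Quotient.mk k, fun g => inclA_injective ?_⟩
  induction g using QuotientGroup.induction_on with
  | H τ =>
    rw [ha', map_sub]
    exact congrArg (· - _) (inclA_rep τ (Submodule.Quotient.mk k)).symm

/-- The condition on inner automorphisms is what lets the same cocycle descend to `Out(G)` with
coefficients in `A_W(G)`. -/
theorem ActsByInversion.exists_two_nsmul (hσ : ActsByInversion σ) {c : H1 (repHomVU ℓ G)}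
    (hc : IsModifiedDiagonalClass ℓ G c) :
    ∃ y : Z1 (repHomVW ℓ G), coeffMapAut ℓ G (H1.mk y) = 2 • c ∧
      ∀ g, y.1 (conj g) ∈ LinearMap.range (commutatorMapW ℓ G) := by
  obtain ⟨s, z, hs, hz, rfl⟩ := hc
  obtain ⟨t, ht⟩ := hσ.exists_coboundary hz hs
  obtain ⟨y, hy⟩ := exists_Z1_repHomVW ht
  have hy' (τ) : inclHom ℓ G (y.1 τ) = 2 • z.1 τ - (repHomVU ℓ G τ t - t) := hy τ
  -- On `conj g` the coboundary of `t` vanishes, since inner automorphisms act trivially on `Hom(V,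
  -- U)`; what remains is `2 • z`, the commutator map at twice the class of `g`.
  refine ⟨y, ?_, fun g => ⟨2 • groupToV ℓ g, inclHom_injective ?_⟩⟩
  · rw [← map_nsmul]
    refine H1.mk_eq_mk.2 ⟨-t, fun τ => ?_⟩
    change inclHom ℓ G (y.1 τ) - 2 • z.1 τ = _
    rw [hy', map_neg]
    abel
  · rw [hy', IsSectionCocycle.apply_conj hz hs, repHomVU_inner ⟨conj g, g, rfl⟩ t, sub_self,
      sub_zero, inclHom_commutatorMapW, map_nsmul]

theorem ActsByInversion.exists_coeffMapOut_eq (hσ : ActsByInversion σ) {j : H1 (repAOut ℓ G)}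
    (hj : IsJohnsonClass ℓ G j) : ∃ y, coeffMapOut ℓ G y = 2 • j := by
  obtain ⟨c, hc, h⟩ := hj
  obtain ⟨y, hyc, hy⟩ := hσ.exists_two_nsmul hc
  obtain ⟨yA, hyA⟩ : ∃ yA : Z1 (repAW ℓ G), ∀ τ, yA.1 τ = Submodule.Quotient.mk (y.1 τ) :=
    ⟨⟨fun τ => Submodule.Quotient.mk (y.1 τ), continuous_quot_mk.comp y.2.1, fun σ τ =>
      congrArg Submodule.Quotient.mk (y.2.2 σ τ)⟩, fun _ => rfl⟩
  obtain ⟨x, hx⟩ := exists_Z1_ofQuotient (Inn G) yA (by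
    rintro _ ⟨g, rfl⟩
    rw [hyA]
    exact (Submodule.Quotient.mk_eq_zero _).2 (hy g))
  refine ⟨H1.mk x, inflation_injective ?_⟩
  rw [map_nsmul, h, ← map_nsmul, ← hyc]
  refine H1.mk_eq_mk.2 ⟨0, fun τ => ?_⟩
  rw [map_zero, sub_zero, sub_eq_zero]
  change inclA ℓ G (x.1 (τ : ContOut G)) = Submodule.Quotient.mk (inclHom ℓ G (y.1 τ))
  exact congrArg (inclA ℓ G) ((hx τ).trans (hyA τ))

end Inversion

end ProEll

theorem mainTheorem9 (ℓ : ℕ) [Fact ℓ.Prime]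
    (G : Type u) [Group G] [TopologicalSpace G] [IsTopologicalGroup G]
    [CompactSpace G] [T2Space G] [TotallyDisconnectedSpace G]
    (hproEll : ∀ N : OpenNormalSubgroup G, IsPGroup ℓ (G ⧸ N.toSubgroup))
    (hfg : ∃ S : Finset G, (Subgroup.closure (S : Set G)).topologicalClosure = ⊤)
    (htf : IsMulTorsionFree (TopologicalAbelianization G)) :
    (∃! c, ProEll.IsModifiedDiagonalClass ℓ G c) ∧
    (∃! j, ProEll.IsJohnsonClass ℓ G j) ∧
    ((∃ σ : ProEll.ContAut G, ∀ g : G,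
        ((σ g : G) : TopologicalAbelianization G) = ((g : G) : TopologicalAbelianization G)⁻¹) →
      (∀ c, ProEll.IsModifiedDiagonalClass ℓ G c →
        (∃ x, ProEll.coeffMapAut ℓ G x = 4 • c) ∧
        (ProEll.H0ModTwoVanishes ℓ (ProEll.repHomVU ℓ G) →
          ∃! x, ProEll.coeffMapAut ℓ G x = 2 • c)) ∧
      (∀ j, ProEll.IsJohnsonClass ℓ G j →
        (∃ y, ProEll.coeffMapOut ℓ G y = 4 • j) ∧
        (ProEll.H0ModTwoVanishes ℓ (ProEll.repHomVUOut ℓ G) →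
          ∃! y, ProEll.coeffMapOut ℓ G y = 2 • j))) := by
  have : ProEll.TopologicallyFG G := ⟨hfg⟩
  have := ProEll.isTorsionFree_V hproEll htf
  have hfree : Module.Free ℤ_[ℓ] (ProEll.V ℓ G) := inferInstance
  obtain ⟨c, hc⟩ := ProEll.exists_isModifiedDiagonalClass (ℓ := ℓ) (G := G)
  obtain ⟨j, hj⟩ := ProEll.exists_isJohnsonClass hc
  refine ⟨⟨c, hc, fun c' hc' => ProEll.isModifiedDiagonalClass_unique hc' hc⟩,
    ⟨j, hj, fun j' hj' => ProEll.isJohnsonClass_unique hj' hj⟩, ?_⟩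
  rintro ⟨σ, hσ⟩
  replace hσ : ProEll.ActsByInversion σ := hσ
  refine ⟨fun c hc => ?_, fun j hj => ?_⟩
  · obtain ⟨y, hy, -⟩ := hσ.exists_two_nsmul hc
    -- A lift of `4 • c` is twice the lift of `2 • c`.
    refine ⟨⟨2 • ProEll.H1.mk y, ?_⟩, fun _ => ⟨_, hy, fun x hx =>
      hσ.coeffMapAut_injective (hx.trans hy.symm)⟩⟩
    rw [map_nsmul, hy, ← mul_nsmul]
  · obtain ⟨y, hy⟩ := hσ.exists_coeffMapOut_eq hj
    refine ⟨⟨2 • y, ?_⟩, fun _ => ⟨_, hy, fun x hx =>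
      hσ.coeffMapOut_injective (hx.trans hy.symm)⟩⟩
    rw [map_nsmul, hy, ← mul_nsmul]
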